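/- Let $\mathcal M$ be a finite set of positive integers, all divisible by $24$, let $\delta:\mathcal M\to\mathbb Z$, $m\mapsto\delta_m$, and consider the eta-quotient $\eta^\delta(q)=\prod_{m\in\mathcal M}\eta(q^m)^{\delta_m}$. Below, $m$ runs over $\mathcal M$. For $k\ge 1$ and $n\in\mathbb Z$, its HRR coefficient is $$A_k(n)=\sum_{\substack{0\le h<k\\ (h,k)=1}}\exp\Bigl(-2\pi i\Bigl(\tfrac{hn}{k}+\tfrac12\sum_m\delta_m\,s\bigl(\tfrac{mh}{\gcd(m,k)},\tfrac{k}{\gcd(m,k)}\bigr)\Bigr)\Bigr),$$ where $s(a,b)=\sum_{j=0}^{b-1}((\tfrac jb))((\tfrac{aj}b))$ is the Dedekind sum, with $((x))=x-\lfloor x\rfloor-\tfrac12$ for $x\notin\mathbb Z$ and $((x))=0$ for $x\in\mathbb Z$. For a Dirichlet character $\chi$ modulo $k$ and $a,b\in\mathbb Z$, let $$S_\chi(a,b;k)=\sum_{\substack{0\le h<k\\ (h,k)=1}}\chi(h)\exp\bigl(\tfrac{2\pi i}{k}(ah+b\overline h)\bigr),\qquad h\overline h\equiv1\pmod k.$$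 Fix $k\ge1$. Put $\lambda=\operatorname{val}_2(k)$ and, for each $m$, $k_m=k/\gcd(m,k)$, $m_k=m/\gcd(m,k)$, $\lambda_m=\operatorname{val}_2(k_m)$, $k_m'=k_m/2^{\lambda_m}$. Choose integers as follows. - $u_m=1$ if $3\mid k_m$; otherwise $u_m\equiv1\pmod{k_m}$ and $u_m\equiv0\pmod 3$. - $v_m$ is an inverse of $m_k$ modulo $\gcd(3,k_m)k_m$. - If $2\mid k_m$, $w_m$ is an inverse of $m_k$ modulo $2^{3+\lambda}$. - $t_1\equiv1\pmod{3k/2^\lambda}$ and $t_1\equiv0\pmod{2^{3+\lambda}}$. - $t_2\equiv1\pmod{2^{3+\lambda}}$ and $t_2\equiv0\pmod{3k/2^\lambda}$. Let $$a_1=-\sum_m\delta_mu_mm,\quad b_1=-\sum_m\delta_mu_mv_m\gcd(m,k),\quad a_2=-\sum_{2\mid k_m}\delta_mm,\quad b_2=-\sum_{2\mid k_m}\delta_mw_m\gcd(m,k)(k_m^2+3k_m+1),$$ $$a=\frac{t_1a_1+t_2a_2}{24},\qquad b=\frac{t_1b_1+t_2b_2}{24},\qquad c=\tfrac12\sum_{2\nmid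 k_m}\delta_m(k_m-3)+\sum_m\delta_m\left(\frac{(-1)^{k_m}m_k}{k_m'}\right),\qquad \chi=\prod_{2\nmid\delta_m}\left(\frac{\cdot}{k_m'}\right)$$ (Jacobi symbols), and for odd $h$ $$\psi(h)=\prod_{\substack{2\nmid\delta_m,\ 2\mid k_m\\ k_m'\equiv1\,(4)}}(-1)^{\frac{hm_k-1}{2}}\prod_{\substack{2\nmid\delta_m,\ 2\mid k_m\\ 2\nmid\lambda_m}}(-1)^{\frac{(hm_k)^2-1}{8}},\qquad \rho(h)=\psi(1)\psi(h).$$ Theorem. For every positive integer $k$ and all choices as above, $a$ and $b$ are integers, $\chi$ defines a Dirichlet character modulo $k$, $\rho$ is a character modulo $8$, there is a Dirichlet character $\chi\rho$ modulo $k$ with $(\chi\rho)(h)=\chi(h)\rho(h)$ for every $h$ coprime to $2k$, and for every $n\in\mathbb Z$ $$A_k(n)=i^{c}\,\psi(1)\,S_{\chi\rho}(a-n,b;k).$$ -/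

import Mathlib

open scoped BigOperators

noncomputable section

namespace HRR

/-- The sawtooth function `((x))`: `x - ⌊x⌋ - 1/2` if `x` is not an integer, and `0` otherwise. -/
def sawtooth (x : ℚ) : ℚ :=
  if Int.fract x = 0 then 0 else x - (⌊x⌋ : ℚ) - 1 / 2

/-- The Dedekind sum `s(a, b) = ∑_{0 ≤ j < b} ((j / b)) ((a j / b))`, for `b > 0`. -/
def dedekindSum (a : ℤ) (b : ℕ) : ℚ :=
  ∑ j ∈ Finset.range b, sawtooth ((j : ℚ) / (b : ℚ)) * sawtooth ((a : ℚ) * (j : ℚ) / (b : ℚ))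

/-- `k_m = k / gcd(m, k)`. -/
def kSub (k m : ℕ) : ℕ := k / Nat.gcd m k

/-- `m_k = m / gcd(m, k)`. -/
def mSub (k m : ℕ) : ℕ := m / Nat.gcd m k

/-- The odd part of a positive integer. -/
def oddPart (n : ℕ) : ℕ := n / 2 ^ padicValNat 2 n

/-- The Hardy-Ramanujan-Rademacher coefficient `A_k(n)` of the eta-quotient
`∏_{m ∈ M} η(q^m)^{δ m}`:
the sum over `0 ≤ h < k` with `gcd(h, k) = 1` of
`exp(-2πi (h n / k + (1/2) ∑_m δ_m s(m h / gcd(m, k), k / gcd(m, k))))`. -/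
def hrrCoeff (M : Finset ℕ) (δ : ℕ → ℤ) (k : ℕ) (n : ℤ) : ℂ :=
  ∑ h ∈ (Finset.range k).filter (fun h => Nat.Coprime h k),
    Complex.exp (-2 * (Real.pi : ℂ) * Complex.I *
      ((h : ℂ) * (n : ℂ) / (k : ℂ) +
        1 / 2 * ∑ m ∈ M, (δ m : ℂ) *
          ((dedekindSum ((mSub k m : ℤ) * (h : ℤ)) (kSub k m) : ℚ) : ℂ)))

/-- The twisted Kloosterman sum `S_χ(a, b; k)`: the sum over `0 ≤ h < k` with `gcd(h, k) = 1` of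
`χ(h) exp((2πi / k) (a h + b h'))`, where `h'` is an inverse of `h` modulo `k`
(here its representative in `[0, k)`). -/
def twistedKloosterman {k : ℕ} (χ : DirichletCharacter ℂ k) (a b : ℤ) : ℂ :=
  ∑ h ∈ (Finset.range k).filter (fun h => Nat.Coprime h k),
    χ (h : ZMod k) *
      Complex.exp (2 * (Real.pi : ℂ) * Complex.I / (k : ℂ) *
        ((a : ℂ) * (h : ℂ) + (b : ℂ) * (((h : ZMod k)⁻¹).val : ℂ)))

/-- `a₁ = -∑_m δ_m u_m m`. -/
def aOne (M : Finset ℕ) (δ u : ℕ → ℤ) : ℤ :=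
  -∑ m ∈ M, δ m * u m * (m : ℤ)

/-- `b₁ = -∑_m δ_m u_m v_m gcd(m, k)`. -/
def bOne (M : Finset ℕ) (δ : ℕ → ℤ) (k : ℕ) (u v : ℕ → ℤ) : ℤ :=
  -∑ m ∈ M, δ m * u m * v m * (Nat.gcd m k : ℤ)

/-- `a₂ = -∑_{2 ∣ k_m} δ_m m`. -/
def aTwo (M : Finset ℕ) (δ : ℕ → ℤ) (k : ℕ) : ℤ :=
  -∑ m ∈ M.filter (fun m => 2 ∣ kSub k m), δ m * (m : ℤ)

/-- `b₂ = -∑_{2 ∣ k_m} δ_m w_m gcd(m, k) (k_m² + 3 k_m + 1)`. -/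
def bTwo (M : Finset ℕ) (δ : ℕ → ℤ) (k : ℕ) (w : ℕ → ℤ) : ℤ :=
  -∑ m ∈ M.filter (fun m => 2 ∣ kSub k m),
    δ m * w m * (Nat.gcd m k : ℤ) * ((kSub k m : ℤ) ^ 2 + 3 * (kSub k m : ℤ) + 1)

/-- The sign `ψ(h)`, for odd `h`. The first product runs over the `m` with `δ_m` odd, `k_m` even
and odd part of `k_m` congruent to `1` modulo `4`; the second one over the `m` with `δ_m` odd,
`k_m` even and odd 2-adic valuation of `k_m`. In both, `h m_k` is odd, so the divisions are
exact. -/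
def psi (M : Finset ℕ) (δ : ℕ → ℤ) (k : ℕ) (h : ℤ) : ℤˣ :=
  (∏ m ∈ M.filter (fun m => ¬ (2 : ℤ) ∣ δ m ∧ 2 ∣ kSub k m ∧ oddPart (kSub k m) % 4 = 1),
      (-1 : ℤˣ) ^ ((h * (mSub k m : ℤ) - 1) / 2)) *
    ∏ m ∈ M.filter (fun m => ¬ (2 : ℤ) ∣ δ m ∧ 2 ∣ kSub k m ∧ ¬ 2 ∣ padicValNat 2 (kSub k m)),
      (-1 : ℤˣ) ^ (((h * (mSub k m : ℤ)) ^ 2 - 1) / 8)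

/-- The exponent
`c = ∑_{2 ∤ k_m} δ_m (k_m - 3) / 2 + ∑_m δ_m ((-1)^{k_m} m_k | k'_m)`,
with `k'_m` the odd part of `k_m` and `(· | ·)` the Jacobi symbol.
In the first sum `k_m - 3` is even, so the division is exact. -/
def cExp (M : Finset ℕ) (δ : ℕ → ℤ) (k : ℕ) : ℤ :=
  (∑ m ∈ M.filter (fun m => ¬ 2 ∣ kSub k m), δ m * (((kSub k m : ℤ) - 3) / 2)) +
    ∑ m ∈ M, δ m * jacobiSym ((-1) ^ kSub k m * (mSub k m : ℤ)) (oddPart (kSub k m))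

/-- The value at `h` of `χ = ∏_{2 ∤ δ_m} (· | k'_m)`, a product of Jacobi symbols. -/
def chiVal (M : Finset ℕ) (δ : ℕ → ℤ) (k : ℕ) (h : ℤ) : ℤ :=
  ∏ m ∈ M.filter (fun m => ¬ (2 : ℤ) ∣ δ m), jacobiSym h (oddPart (kSub k m))

end HRR

end

/-!
For `h` prime to `k`, `12 k s(h, k)` is an integer `D`, so `exp (-π i s(h, k))` depends only on `D`
modulo `24 k`. Squaring `j ↦ h j mod k` gives `h D ≡ h² + 1` modulo `k`, and modulo `3 k` when
`3 ∣ k`, while `3 ∣ D` otherwise; this determines `D` modulo `3 k`. Modulo `8` and, for even `k`,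
modulo higher powers of `2`, one uses the congruence `D ≡ k + 1 - 2 (h | k)` modulo `8` for odd `k`
and reciprocity. The Chinese remainder theorem glues the two into a term linear in `h` and `h⁻¹`,
plus `-6 k` times an exponent in which `h` enters through signs only. With `k_m` in place of `k`,
one multiplies by `δ_m gcd(m, k)`, sums over `m`, and exponentiates once: the linear terms become
those of the Kloosterman sum, and since `i ^ (j ε) = i ^ j ε` for signs `j` and `ε`, the Jacobi
symbols become the characters.
-/

namespace HRR

section DedekindSum

variable {h : ℤ} {k : ℕ}

theorem sum_range_mul_emod {R : Type*} [AddCommMonoid R] (hc : IsCoprime h (k : ℤ)) (f : ℤ → R) :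
    ∑ j ∈ Finset.range k, f (h * j % k) = ∑ j ∈ Finset.range k, f j := by
  have hcast : ∀ j ∈ Finset.range k, (((h * j % k).toNat : ℕ) : ℤ) = h * j % k := fun j hj =>
    Int.toNat_of_nonneg (Int.emod_nonneg _ (by have := Finset.mem_range.mp hj; omega))
  have hmaps : Set.MapsTo (fun j : ℕ => (h * j % k).toNat) (Finset.range k) (Finset.range k) := by
    intro j hj
    have hlt := Int.emod_lt_of_pos (h * j) (b := (k : ℤ)) (by have := Finset.mem_range.mp hj; omega)
    rw [← hcast j hj] at hlt
    exact Finset.mem_coe.mpr (Finset.mem_range.mpr (by exact_mod_cast hlt))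
  have hinj : Set.InjOn (fun j : ℕ => (h * j % k).toNat) (Finset.range k) := by
    intro i hi j hj hij
    have hmod : h * i ≡ h * j [ZMOD k] := by
      rw [Int.ModEq, ← hcast i hi, ← hcast j hj]
      exact congrArg Nat.cast hij
    have hdvd : (k : ℤ) ∣ j - i := hc.symm.dvd_of_dvd_mul_left (by rw [mul_sub]; exact hmod.dvd)
    exact (Nat.modEq_iff_dvd.mpr hdvd).eq_of_lt_of_lt (Finset.mem_range.mp hi)
      (Finset.mem_range.mp hj)
  exact Finset.sum_nbij _ hmaps hinj (Finset.surjOn_of_injOn_of_card_le _ hmaps hinj le_rfl)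
    fun j hj => by rw [hcast j hj]

theorem two_mul_sum_range_cast (R : Type*) [CommRing R] (k : ℕ) :
    2 * ∑ j ∈ Finset.range k, (j : R) = k * (k - 1) := by
  induction k with
  | zero => simp
  | succ n ih => rw [Finset.sum_range_succ, mul_add, ih]; push_cast; ring

theorem six_mul_sum_range_sq (R : Type*) [CommRing R] (k : ℕ) :
    6 * ∑ j ∈ Finset.range k, (j : R) ^ 2 = k * (k - 1) * (2 * k - 1) := by
  induction k with
  | zero => simp
  | succ n ih => rw [Finset.sum_range_succ, mul_add, ih]; push_cast; ring

/-- The numerator `12 k s(h, k)` of the Dedekind sum of coprime `h` and `k`, written in a form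
that shows it to be an integer. -/
def dedekindNum (h : ℤ) (k : ℕ) : ℤ :=
  2 * h * (k - 1) * (2 * k - 1) - 12 * ∑ j ∈ Finset.range k, (j : ℤ) * (h * j / k) -
    3 * k * (k - 1)

theorem sawtooth_intCast_div (a : ℤ) (hk : 0 < k) :
    sawtooth ((a : ℚ) / k) = if (k : ℤ) ∣ a then 0 else ((a % k : ℤ) : ℚ) / k - 1 / 2 := by
  have hk' : (k : ℚ) ≠ 0 := by positivity
  have hfract : Int.fract ((a : ℚ) / k) = ((a % k : ℤ) : ℚ) / k := by
    exact_mod_cast Int.fract_div_intCast_eq_div_intCast_mod (k := ℚ) (m := a) (n := k)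
  have hzero : ((a % k : ℤ) : ℚ) / k = 0 ↔ (k : ℤ) ∣ a := by
    rw [div_eq_zero_iff, or_iff_left hk', Int.cast_eq_zero, Int.dvd_iff_emod_eq_zero]
  rw [sawtooth, Int.self_sub_floor, hfract]
  simp only [hzero]

theorem dedekindSum_eq_sum_emod (hk : 0 < k) (hc : IsCoprime h (k : ℤ)) :
    dedekindSum h k =
      ∑ j ∈ Finset.range k, ((j : ℚ) / k - 1 / 2) * (((h * j % k : ℤ) : ℚ) / k - 1 / 2) -
        1 / 4 := by
  have hquarter : ∑ j ∈ Finset.range k, (if j = 0 then (1 / 4 : ℚ) else 0) = 1 / 4 := by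
    rw [Finset.sum_ite_eq', if_pos (Finset.mem_range.mpr hk)]
  rw [dedekindSum, ← hquarter, ← Finset.sum_sub_distrib]
  refine Finset.sum_congr rfl fun j hj => ?_
  have hjk := Finset.mem_range.mp hj
  have hdvd : (k : ℤ) ∣ j ↔ j = 0 := by
    rw [Int.natCast_dvd_natCast]
    exact ⟨fun hd => Nat.eq_zero_of_dvd_of_lt hd hjk, fun h0 => h0 ▸ dvd_zero k⟩
  have hdvd' : (k : ℤ) ∣ h * j ↔ j = 0 := by
    rw [← hdvd]
    exact ⟨hc.symm.dvd_of_dvd_mul_left, fun hd => hd.mul_left h⟩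
  have hj₁ := sawtooth_intCast_div j hk
  have hj₂ := sawtooth_intCast_div (h * j) hk
  rw [Int.emod_eq_of_lt (Int.natCast_nonneg j) (by exact_mod_cast hjk)] at hj₁
  simp only [Int.cast_natCast, Int.cast_mul, hdvd, hdvd'] at hj₁ hj₂
  rw [hj₁, hj₂]
  split_ifs with h0
  · simp [h0]; norm_num
  · simp

theorem sum_mul_emod (h : ℤ) (k : ℕ) :
    ∑ j ∈ Finset.range k, (j : ℤ) * (h * j % k) =
      h * ∑ j ∈ Finset.range k, (j : ℤ) ^ 2 -
        k * ∑ j ∈ Finset.range k, (j : ℤ) * (h * j / k) := by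
  rw [Finset.mul_sum, Finset.mul_sum, ← Finset.sum_sub_distrib]
  refine Finset.sum_congr rfl fun j _ => ?_
  rw [Int.emod_def]
  ring

theorem twelve_mul_dedekindSum (hk : 0 < k) (hc : IsCoprime h (k : ℤ)) :
    12 * (k : ℚ) * dedekindSum h k = dedekindNum h k := by
  have hk' : (k : ℚ) ≠ 0 := by positivity
  have hexpand : ∑ j ∈ Finset.range k,
      ((j : ℚ) / k - 1 / 2) * (((h * j % k : ℤ) : ℚ) / k - 1 / 2) =
      (∑ j ∈ Finset.range k, (j : ℚ) * ((h * j % k : ℤ) : ℚ)) / k ^ 2 -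
        (∑ j ∈ Finset.range k, (j : ℚ)) / (2 * k) -
        (∑ j ∈ Finset.range k, ((h * j % k : ℤ) : ℚ)) / (2 * k) + k / 4 := by
    have hconst : (k : ℚ) / 4 = ∑ _j ∈ Finset.range k, (1 / 4 : ℚ) := by
      rw [Finset.sum_const, Finset.card_range, nsmul_eq_mul, mul_one_div]
    simp only [hconst, Finset.sum_div, ← Finset.sum_sub_distrib, ← Finset.sum_add_distrib]
    refine Finset.sum_congr rfl fun j _ => ?_
    field_simp
    ring
  have hsum : ∑ j ∈ Finset.range k, (j : ℚ) = k * (k - 1) / 2 := by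
    rw [← two_mul_sum_range_cast, mul_div_cancel_left₀ _ two_ne_zero]
  have hsq : ∑ j ∈ Finset.range k, (j : ℚ) ^ 2 = k * (k - 1) * (2 * k - 1) / 6 := by
    rw [← six_mul_sum_range_sq, mul_div_cancel_left₀ _ (by norm_num)]
  have hprod := congrArg (Int.cast : ℤ → ℚ) (sum_mul_emod h k)
  have hperm := sum_range_mul_emod hc (fun x => (x : ℚ))
  simp only [Int.cast_sum, Int.cast_mul, Int.cast_sub, Int.cast_pow, Int.cast_natCast]
    at hprod hperm
  rw [dedekindSum_eq_sum_emod hk hc, hexpand, hprod, hperm, hsum, hsq, dedekindNum]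
  push_cast
  field_simp
  ring

theorem sawtooth_neg (x : ℚ) : sawtooth (-x) = -sawtooth x := by
  simp only [sawtooth, Int.self_sub_floor, Int.fract_neg_eq_zero]
  split_ifs with hx
  · exact neg_zero.symm
  · rw [Int.fract_neg hx]
    ring

theorem dedekindSum_neg (h : ℤ) (k : ℕ) : dedekindSum (-h) k = -dedekindSum h k := by
  simp only [dedekindSum, Int.cast_neg, neg_mul, neg_div, sawtooth_neg, mul_neg,
    Finset.sum_neg_distrib]

theorem dedekindNum_neg (hk : 0 < k) (hc : IsCoprime h (k : ℤ)) :
    dedekindNum (-h) k = -dedekindNum h k := by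
  have hneg : (dedekindNum (-h) k : ℚ) = -dedekindNum h k := by
    rw [← twelve_mul_dedekindSum hk hc, ← twelve_mul_dedekindSum hk hc.neg_left, dedekindSum_neg,
      mul_neg]
  exact_mod_cast hneg

theorem dedekindNum_add_mul (h c : ℤ) (k : ℕ) :
    dedekindNum (h + k * c) k = dedekindNum h k := by
  have hterm : ∀ j ∈ Finset.range k, (j : ℤ) * ((h + k * c) * j / k) =
      (j : ℤ) * (h * j / k) + c * (j : ℤ) ^ 2 := by
    intro j hj
    have hk' : (k : ℤ) ≠ 0 := by have := Finset.mem_range.mp hj; omega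
    rw [show (h + k * c) * (j : ℤ) = h * j + (c * j) * k by ring, Int.add_mul_ediv_right _ _ hk']
    ring
  rw [dedekindNum, dedekindNum, Finset.sum_congr rfl hterm, Finset.sum_add_distrib,
    ← Finset.mul_sum]
  linear_combination (-2 * c) * six_mul_sum_range_sq ℤ k

theorem dedekindNum_emod (h : ℤ) (k : ℕ) : dedekindNum (h % k) k = dedekindNum h k := by
  rw [← dedekindNum_add_mul (h % k) (h / k) k, Int.emod_add_mul_ediv]

theorem mul_dedekindNum (hk : 0 < k) (hc : IsCoprime h (k : ℤ)) :
    h * dedekindNum h k = (h ^ 2 + 1) * (k - 1) * (2 * k - 1) -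
      6 * k * ∑ j ∈ Finset.range k, (h * j / k) ^ 2 - 3 * h * k * (k - 1) := by
  have hexpand : ∑ j ∈ Finset.range k, (h * j % k) ^ 2 =
      h ^ 2 * ∑ j ∈ Finset.range k, (j : ℤ) ^ 2
        - 2 * h * k * ∑ j ∈ Finset.range k, (j : ℤ) * (h * j / k)
        + k ^ 2 * ∑ j ∈ Finset.range k, (h * j / k) ^ 2 := by
    simp only [Finset.mul_sum, ← Finset.sum_sub_distrib, ← Finset.sum_add_distrib]
    refine Finset.sum_congr rfl fun j _ => ?_
    rw [Int.emod_def]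
    ring
  have hperm := sum_range_mul_emod hc (fun x => x ^ 2)
  rw [hexpand] at hperm
  apply mul_left_cancel₀ (Int.natCast_ne_zero.mpr hk.ne')
  rw [dedekindNum]
  linear_combination 6 * hperm - (h ^ 2 - 1) * six_mul_sum_range_sq ℤ k

theorem mul_dedekindNum_modEq (hk : 0 < k) (hc : IsCoprime h (k : ℤ)) :
    h * dedekindNum h k ≡ h ^ 2 + 1 [ZMOD (Nat.gcd 3 k * k : ℕ)] := by
  obtain ⟨a, ha⟩ : Nat.gcd 3 k ∣ 3 := Nat.gcd_dvd_left 3 k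
  obtain ⟨b, hb⟩ : Nat.gcd 3 k ∣ k := Nat.gcd_dvd_right 3 k
  generalize Nat.gcd 3 k = θ at ha hb ⊢
  have ha' : (3 : ℤ) = θ * a := by exact_mod_cast ha
  have hb' : (k : ℤ) = θ * b := by exact_mod_cast hb
  rw [mul_dedekindNum hk hc, Nat.cast_mul]
  refine Int.modEq_iff_dvd.mpr ⟨a * (h ^ 2 + 1) - 2 * b * (h ^ 2 + 1) +
    2 * a * ∑ j ∈ Finset.range k, (h * j / k) ^ 2 + h * a * (k - 1), ?_⟩
  linear_combination ((h ^ 2 + 1) * k + 2 * k * ∑ j ∈ Finset.range k, (h * j / k) ^ 2 +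
    h * k * (k - 1)) * ha' - (2 * k * (h ^ 2 + 1)) * hb'

theorem dedekindNum_modEq_add {h' : ℤ} (hk : 0 < k) (hc : IsCoprime h (k : ℤ))
    (hh' : h * h' ≡ 1 [ZMOD (Nat.gcd 3 k * k : ℕ)]) :
    dedekindNum h k ≡ h + h' [ZMOD (Nat.gcd 3 k * k : ℕ)] :=
  calc dedekindNum h k = 1 * dedekindNum h k := (one_mul _).symm
    _ ≡ h * h' * dedekindNum h k [ZMOD (Nat.gcd 3 k * k : ℕ)] := hh'.symm.mul_right _
    _ = h' * (h * dedekindNum h k) := by ring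
    _ ≡ h' * (h ^ 2 + 1) [ZMOD (Nat.gcd 3 k * k : ℕ)] := (mul_dedekindNum_modEq hk hc).mul_left _
    _ = h * (h * h') + h' := by ring
    _ ≡ h * 1 + h' [ZMOD (Nat.gcd 3 k * k : ℕ)] := (hh'.mul_left h).add_right h'
    _ = h + h' := by rw [mul_one]

theorem three_dvd_dedekindNum (h : ℤ) (h3 : ¬ 3 ∣ k) : 3 ∣ dedekindNum h k := by
  obtain ⟨c, hc⟩ : (3 : ℤ) ∣ (k - 1) * (2 * k - 1) := by
    rcases (by omega : (k : ℤ) % 3 = 1 ∨ (k : ℤ) % 3 = 2) with hk | hk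
    · exact Dvd.dvd.mul_right (by omega) _
    · exact Dvd.dvd.mul_left (by omega) _
  refine ⟨2 * h * c - 4 * ∑ j ∈ Finset.range k, (j : ℤ) * (h * j / k) - k * (k - 1), ?_⟩
  rw [dedekindNum]
  linear_combination 2 * h * hc

theorem dedekindNum_modEq_three_mul {h' u : ℤ} (hk : 0 < k) (hc : IsCoprime h (k : ℤ))
    (hh' : h * h' ≡ 1 [ZMOD (Nat.gcd 3 k * k : ℕ)]) (hu₁ : 3 ∣ k → u = 1)
    (hu₂ : ¬ 3 ∣ k → u ≡ 1 [ZMOD k] ∧ u ≡ 0 [ZMOD 3]) :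
    dedekindNum h k ≡ u * (h + h') [ZMOD (3 * k : ℕ)] := by
  have hD := dedekindNum_modEq_add hk hc hh'
  by_cases h3 : 3 ∣ k
  · rwa [hu₁ h3, one_mul, ← Nat.gcd_eq_left h3]
  · have hgcd : Nat.gcd 3 k = 1 := (Nat.Prime.coprime_iff_not_dvd Nat.prime_three).mpr h3
    obtain ⟨huk, hu3⟩ := hu₂ h3
    rw [hgcd, one_mul] at hD
    rw [Nat.cast_mul, Nat.cast_ofNat]
    have hcop : IsCoprime (3 : ℤ) k := by exact_mod_cast Nat.isCoprime_iff_coprime.mpr hgcd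
    refine Int.modEq_iff_dvd.mpr (hcop.mul_dvd (Int.ModEq.dvd ?_) (hD.trans ?_).dvd)
    · exact (Int.modEq_zero_iff_dvd.mpr (three_dvd_dedekindNum h h3)).trans
        (by simpa using (hu3.mul_right (h + h')).symm)
    · simpa using (huk.mul_right (h + h')).symm

end DedekindSum

section Reciprocity

variable {h k : ℕ}

theorem sum_Ico_two_mul_sub_one (n : ℕ) :
    ∑ i ∈ Finset.Ico 1 (n + 1), (2 * (i : ℤ) - 1) = (n : ℤ) ^ 2 := by
  induction n with
  | zero => simp
  | succ n ih => rw [Finset.sum_Ico_succ_top (by omega), ih]; push_cast; ring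

theorem ediv_sq_eq_sum_ite (hh : 0 < h) {j : ℕ} (hj : j < k) :
    ((h : ℤ) * j / k) ^ 2 =
      ∑ i ∈ Finset.Ico 1 h, if k * i ≤ h * j then 2 * (i : ℤ) - 1 else 0 := by
  have hk : 0 < k := by omega
  have hlt : h * j / k < h := by
    rw [Nat.div_lt_iff_lt_mul hk]
    exact Nat.mul_lt_mul_of_pos_left hj hh
  have hfilter : (Finset.Ico 1 h).filter (fun i => k * i ≤ h * j) =
      Finset.Ico 1 (h * j / k + 1) := by
    ext i
    rw [Finset.mem_filter, Finset.mem_Ico, Finset.mem_Ico, Nat.lt_succ_iff,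
      Nat.le_div_iff_mul_le hk, mul_comm i k]
    refine ⟨fun hi => ⟨hi.1.1, hi.2⟩, fun hi => ⟨⟨hi.1, lt_of_le_of_lt ?_ hlt⟩, hi.2⟩⟩
    rw [Nat.le_div_iff_mul_le hk, mul_comm i k]
    exact hi.2
  rw [← Finset.sum_filter, hfilter, sum_Ico_two_mul_sub_one]
  push_cast
  rfl

theorem card_filter_mul_le (hc : Nat.Coprime h k) (hk : 0 < k) {i : ℕ} (hi : i ∈ Finset.Ico 1 h) :
    (((Finset.range k).filter (fun j => k * i ≤ h * j)).card : ℤ) = k - 1 - (k : ℤ) * i / h := by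
  obtain ⟨hi1, hih⟩ := Finset.mem_Ico.mp hi
  have hh : 0 < h := by omega
  -- the line through the origin and `(h, k)` contains no lattice point strictly in between
  have hne : ∀ j, k * i ≠ h * j := fun j he =>
    absurd (Nat.le_of_dvd hi1 (hc.dvd_of_dvd_mul_left ⟨j, he⟩)) (by omega)
  have hfilter : (Finset.range k).filter (fun j => k * i ≤ h * j) =
      Finset.Ico (k * i / h + 1) k := by
    ext j
    rw [Finset.mem_filter, Finset.mem_range, Finset.mem_Ico, Nat.succ_le_iff,
      Nat.div_lt_iff_lt_mul hh, mul_comm j h, and_comm, (hne j).le_iff_lt]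
  have hlt : k * i / h < k := by
    rw [Nat.div_lt_iff_lt_mul hh]
    exact Nat.mul_lt_mul_of_pos_left hih hk
  rw [hfilter, Nat.card_Ico, Nat.cast_sub hlt]
  push_cast
  ring

theorem sum_ediv_sq (hh : 0 < h) (hk : 0 < k) (hc : Nat.Coprime h k) :
    ∑ j ∈ Finset.range k, ((h : ℤ) * j / k) ^ 2 =
      ∑ i ∈ Finset.Ico 1 h, (2 * (i : ℤ) - 1) * (k - 1 - (k : ℤ) * i / h) := by
  rw [Finset.sum_congr rfl fun j hj => ediv_sq_eq_sum_ite hh (Finset.mem_range.mp hj),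
    Finset.sum_comm]
  refine Finset.sum_congr rfl fun i hi => ?_
  rw [← Finset.sum_filter, Finset.sum_const, nsmul_eq_mul, card_filter_mul_le hc hk hi, mul_comm]

theorem two_mul_sum_ediv {h : ℤ} (hk : 0 < k) (hc : IsCoprime h (k : ℤ)) :
    2 * ∑ j ∈ Finset.range k, (h * j / k) = (h - 1) * (k - 1) := by
  have hperm := sum_range_mul_emod hc (fun x => x)
  simp only [Int.emod_def, Finset.sum_sub_distrib, ← Finset.mul_sum] at hperm
  apply mul_left_cancel₀ (Int.natCast_ne_zero.mpr hk.ne')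
  linear_combination (-2) * hperm + (h - 1) * two_mul_sum_range_cast ℤ k

theorem dedekindNum_reciprocity (hh : 0 < h) (hk : 0 < k) (hc : Nat.Coprime h k) :
    h * dedekindNum h k + k * dedekindNum k h = (h : ℤ) ^ 2 + k ^ 2 + 1 - 3 * h * k := by
  have hc' : IsCoprime (h : ℤ) k := Nat.isCoprime_iff_coprime.mpr hc
  have hsum : ∑ i ∈ Finset.range h, (2 * (i : ℤ) - 1) * (k - 1 - (k : ℤ) * i / h) =
      2 * (k - 1) * ∑ i ∈ Finset.range h, (i : ℤ) -
        2 * ∑ i ∈ Finset.range h, (i : ℤ) * ((k : ℤ) * i / h) - h * (k - 1) +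
        ∑ i ∈ Finset.range h, ((k : ℤ) * i / h) := by
    have hconst : (h : ℤ) * (k - 1) = ∑ _i ∈ Finset.range h, ((k : ℤ) - 1) := by
      rw [Finset.sum_const, Finset.card_range, nsmul_eq_mul]
    simp only [hconst, Finset.mul_sum, ← Finset.sum_sub_distrib, ← Finset.sum_add_distrib]
    exact Finset.sum_congr rfl fun i _ => by ring
  have hsplit := Finset.sum_eq_sum_Ico_succ_bot hh
    fun i => (2 * (i : ℤ) - 1) * (k - 1 - (k : ℤ) * i / h)
  rw [← Finset.range_eq_Ico, zero_add, ← sum_ediv_sq hh hk hc, hsum] at hsplit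
  simp only [Nat.cast_zero, mul_zero, Int.zero_ediv] at hsplit
  rw [mul_dedekindNum hk hc', dedekindNum]
  linear_combination (6 * (k : ℤ)) * hsplit - 6 * k * (k - 1) * two_mul_sum_range_cast ℤ h
    - 3 * (k : ℤ) * two_mul_sum_ediv hh hc'.symm

end Reciprocity

section ModEight

variable {h k : ℕ}

theorem jacobiSym_eq_of_mod_four_eq_one (hh : Odd h) (hk : Odd k) (h4 : h % 4 = 1 ∨ k % 4 = 1) :
    jacobiSym h k = jacobiSym k h := by
  rcases h4 with h4 | h4
  · exact jacobiSym.quadratic_reciprocity_one_mod_four h4 hk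
  · exact (jacobiSym.quadratic_reciprocity_one_mod_four h4 hh).symm

theorem two_mul_jacobiSym_add_modEq (hh : Odd h) (hk : Odd k) (hc : Nat.Coprime h k) :
    2 * (jacobiSym h k + h * k * jacobiSym k h) ≡ (h - 3) * (k - 3) [ZMOD 8] := by
  obtain ⟨s, hs⟩ := hh.add_odd hk
  have hs' : (h : ℤ) + k = s + s := by exact_mod_cast hs
  have hh2 := Nat.odd_iff.mp hh
  have hk2 := Nat.odd_iff.mp hk
  by_cases h4 : h % 4 = 1 ∨ k % 4 = 1
  · obtain ⟨c, hc8⟩ : (8 : ℤ) ∣ (h - 1) * (k - 1) := by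
      rcases h4 with h4 | h4
      · exact mul_dvd_mul (by omega : (4 : ℤ) ∣ h - 1) (by omega : (2 : ℤ) ∣ k - 1)
      · exact mul_dvd_mul (by omega : (2 : ℤ) ∣ h - 1) (by omega : (4 : ℤ) ∣ k - 1)
    rw [jacobiSym_eq_of_mod_four_eq_one hh hk h4]
    rcases jacobiSym.eq_one_or_neg_one (a := k) hc.symm with hJ | hJ <;> rw [hJ]
    · exact Int.modEq_iff_dvd.mpr ⟨1 - c - s, by linear_combination (-1) * hc8 - 4 * hs'⟩
    · exact Int.modEq_iff_dvd.mpr ⟨1 + 3 * c, by linear_combination 3 * hc8⟩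
  · obtain ⟨a, ha⟩ : (4 : ℤ) ∣ h - 3 := by omega
    obtain ⟨b, hb⟩ : (4 : ℤ) ∣ k - 3 := by omega
    rw [jacobiSym.quadratic_reciprocity_three_mod_four (by omega) (by omega)]
    refine Int.modEq_iff_dvd.mpr ⟨2 * a * b - jacobiSym k h * (4 * a * b + 3 * a + 3 * b + 2), ?_⟩
    rw [show (h : ℤ) = 4 * a + 3 by omega, show (k : ℤ) = 4 * b + 3 by omega]
    ring

theorem dedekindNum_modEq_eight_of_swap (hh : Odd h) (hk : Odd k) (hc : Nat.Coprime h k)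
    (hD : dedekindNum k h ≡ h + 1 - 2 * jacobiSym k h [ZMOD 8]) :
    dedekindNum h k ≡ k + 1 - 2 * jacobiSym h k [ZMOD 8] := by
  have hrec := dedekindNum_reciprocity hh.pos hk.pos hc
  obtain ⟨x, hx⟩ := Int.eight_dvd_sq_sub_one_of_odd (by exact_mod_cast hh : Odd (h : ℤ))
  obtain ⟨y, hy⟩ := Int.eight_dvd_sq_sub_one_of_odd (by exact_mod_cast hk : Odd (k : ℤ))
  obtain ⟨c, hD'⟩ := hD.dvd
  obtain ⟨e, hJ⟩ := (two_mul_jacobiSym_add_modEq hh hk hc).dvd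
  refine Int.modEq_iff_dvd.mpr
    ⟨x * (dedekindNum h k - h + 4 * k) - h * y - h * k * c + k - 1 + e, ?_⟩
  linear_combination (-(h : ℤ)) * hrec + (dedekindNum h k - h + 4 * k) * hx - h * hy
    - h * k * hD' + hJ

theorem dedekindNum_modEq_eight_of_neg {h : ℤ} (hk : Odd k) (hc : IsCoprime h (k : ℤ))
    (hD : dedekindNum (-h) k ≡ k + 1 - 2 * jacobiSym (-h) k [ZMOD 8]) :
    dedekindNum h k ≡ k + 1 - 2 * jacobiSym h k [ZMOD 8] := by
  rw [dedekindNum_neg hk.pos hc, jacobiSym.neg _ hk, ZMod.χ₄_nat_eq_if_mod_four] at hD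
  have hk2 := Nat.odd_iff.mp hk
  rw [if_neg (by omega)] at hD
  unfold Int.ModEq at hD ⊢
  rcases jacobiSym.eq_one_or_neg_one (Int.isCoprime_iff_gcd_eq_one.mp hc) with hJ | hJ <;>
    rw [hJ] at hD ⊢ <;> split_ifs at hD <;> omega

theorem dedekindNum_modEq_eight (hk : Odd k) {h : ℤ} (hc : IsCoprime h (k : ℤ)) :
    dedekindNum h k ≡ k + 1 - 2 * jacobiSym h k [ZMOD 8] := by
  induction k using Nat.strong_induction_on generalizing h with
  | _ k ih =>
    have hodd : ∀ r < k, Odd r → Nat.Coprime r k →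
        dedekindNum r k ≡ k + 1 - 2 * jacobiSym r k [ZMOD 8] := fun r hr hro hrc =>
      dedekindNum_modEq_eight_of_swap hro hk hrc
        (ih r hr hro (Nat.isCoprime_iff_coprime.mpr hrc.symm))
    have hk0 : (0 : ℤ) < k := by exact_mod_cast hk.pos
    obtain ⟨r, hr⟩ := Int.eq_ofNat_of_zero_le (Int.emod_nonneg h hk0.ne')
    have hrk : r < k := by
      have := Int.emod_lt_of_pos h hk0
      omega
    have hrc : IsCoprime (r : ℤ) k := by
      rw [← Int.emod_add_mul_ediv h k] at hc
      rw [← hr]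
      exact hc.of_add_mul_left_left
    rw [← dedekindNum_emod, jacobiSym.mod_left, hr]
    rcases Nat.even_or_odd r with hre | hro
    · refine dedekindNum_modEq_eight_of_neg hk hrc ?_
      rcases Nat.eq_zero_or_pos r with rfl | hr0
      · obtain rfl : k = 1 := by simpa using Nat.isCoprime_iff_coprime.mp hrc
        simp [dedekindNum]
      · have hflip := hodd (k - r) (by omega) (Nat.Odd.sub_even hrk.le hk hre)
          ((Nat.coprime_self_sub_left hrk.le).mpr (Nat.isCoprime_iff_coprime.mp hrc))
        have hcast : ((k - r : ℕ) : ℤ) = -(r : ℤ) + k * 1 := by rw [Nat.cast_sub hrk.le]; ring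
        rwa [hcast, dedekindNum_add_mul, jacobiSym.mod_left, Int.add_mul_emod_self_left,
          ← jacobiSym.mod_left] at hflip
    · exact hodd r hrk hro (Nat.isCoprime_iff_coprime.mp hrc)

theorem mul_dedekindNum_modEq_eight_mul (hh : Odd h) (hk : 0 < k) (hc : Nat.Coprime h k) :
    h * dedekindNum h k ≡ (h : ℤ) ^ 2 + k ^ 2 + 3 * k + 1 + 2 * k * jacobiSym k h
      [ZMOD 8 * k] := by
  obtain ⟨c, hD⟩ :=
    (dedekindNum_modEq_eight hh (Nat.isCoprime_iff_coprime.mpr hc.symm)).dvd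
  obtain ⟨a, ha⟩ : Odd (h : ℤ) := by exact_mod_cast hh
  refine Int.modEq_iff_dvd.mpr ⟨a + 1 - c, ?_⟩
  linear_combination (-1) * dedekindNum_reciprocity hh.pos hk hc - k * hD + 4 * k * ha

end ModEight

section OddPart

variable {K k n : ℕ}

theorem two_pow_mul_oddPart (n : ℕ) : 2 ^ padicValNat 2 n * oddPart n = n :=
  Nat.mul_div_cancel' pow_padicValNat_dvd

theorem oddPart_dvd (n : ℕ) : oddPart n ∣ n :=
  Dvd.intro_left _ (two_pow_mul_oddPart n)

theorem odd_oddPart (hn : n ≠ 0) : Odd (oddPart n) := by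
  rw [Nat.odd_iff, ← Nat.two_dvd_ne_zero, oddPart, ← Nat.factorization_def n Nat.prime_two]
  exact Nat.not_dvd_ordCompl Nat.prime_two hn

theorem oddPart_eq_self (hn : Odd n) : oddPart n = n := by
  rw [oddPart, padicValNat.eq_zero_of_not_dvd hn.not_two_dvd_nat, pow_zero, Nat.div_one]

theorem oddPart_dvd_oddPart (h : K ∣ k) : oddPart K ∣ oddPart k := by
  simpa only [oddPart, Nat.factorization_def _ Nat.prime_two] using
    Nat.ordCompl_dvd_ordCompl_of_dvd h 2

theorem two_pow_add_padicValNat_dvd (c : ℕ) (hk : k ≠ 0) (h : K ∣ k) :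
    (2 : ℤ) ^ (c + padicValNat 2 K) ∣ 2 ^ (c + padicValNat 2 k) :=
  pow_dvd_pow _ (Nat.add_le_add_left
    ((padicValNat_dvd_iff_le hk).mp (pow_padicValNat_dvd.trans h)) c)

theorem isCoprime_oddPart_right {h : ℤ} (hc : IsCoprime h (n : ℤ)) :
    IsCoprime h (oddPart n : ℤ) :=
  hc.of_isCoprime_of_dvd_right (Int.natCast_dvd_natCast.mpr (oddPart_dvd n))

end OddPart

section TwoAdicSign

variable {H K : ℕ}

/-- The quadratic character modulo `8` by which `h (K | h)` differs from the Jacobi symbol of `h`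
modulo the odd part of `K`; see `natCast_mul_jacobiSym_modEq`. It is built from
`χ₄ h = (-1) ^ ((h - 1) / 2)` and `χ₈ h = (-1) ^ ((h ^ 2 - 1) / 8)`. -/
def twoAdicSign (K : ℕ) : ℤ →* ℤ where
  toFun h := (if oddPart K % 4 = 1 then ZMod.χ₄ h else 1) *
    (if ¬ 2 ∣ padicValNat 2 K then ZMod.χ₈ h else 1)
  map_one' := by split_ifs <;> simp
  map_mul' a b := by
    simp only [Int.cast_mul, map_mul]
    split_ifs <;> ring

theorem twoAdicSign_apply (K : ℕ) (h : ℤ) :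
    twoAdicSign K h = (if oddPart K % 4 = 1 then ZMod.χ₄ h else 1) *
      (if ¬ 2 ∣ padicValNat 2 K then ZMod.χ₈ h else 1) :=
  rfl

theorem isUnit_χ₄ {h : ℤ} (hh : Odd h) : IsUnit (ZMod.χ₄ h) := by
  have := Int.odd_iff.mp hh
  rw [ZMod.χ₄_int_eq_if_mod_four, if_neg (by omega)]
  split_ifs <;> simp

theorem isUnit_χ₈ {h : ℤ} (hh : Odd h) : IsUnit (ZMod.χ₈ h) := by
  have := Int.odd_iff.mp hh
  rw [ZMod.χ₈_int_eq_if_mod_eight, if_neg (by omega)]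
  split_ifs <;> simp

theorem isUnit_twoAdicSign (K : ℕ) {h : ℤ} (hh : Odd h) : IsUnit (twoAdicSign K h) := by
  rw [twoAdicSign_apply]
  refine IsUnit.mul ?_ ?_
  · split_ifs
    exacts [isUnit_χ₄ hh, isUnit_one]
  · split_ifs
    exacts [isUnit_one, isUnit_χ₈ hh]

theorem twoAdicSign_congr (K : ℕ) {a b : ℤ} (hab : a ≡ b [ZMOD 8]) :
    twoAdicSign K a = twoAdicSign K b := by
  have h₄ : (a : ZMod 4) = b :=
    (ZMod.intCast_eq_intCast_iff _ _ 4).mpr (hab.of_dvd (by norm_num))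
  have h₈ : (a : ZMod 8) = b := (ZMod.intCast_eq_intCast_iff _ _ 8).mpr hab
  rw [twoAdicSign_apply, twoAdicSign_apply, h₄, h₈]

theorem χ₄_modEq_self {h : ℤ} (hh : Odd h) : ZMod.χ₄ h ≡ h [ZMOD 4] := by
  have := Int.odd_iff.mp hh
  rw [ZMod.χ₄_int_eq_if_mod_four, Int.ModEq]
  split_ifs <;> omega

theorem natCast_mul_jacobiSym_modEq_of_odd (hH : Odd H) (hK : Odd K) :
    H * jacobiSym K H ≡ jacobiSym H K * (if K % 4 = 1 then ZMod.χ₄ H else 1) [ZMOD 4] := by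
  have hH2 := Nat.odd_iff.mp hH
  have hK2 := Nat.odd_iff.mp hK
  split_ifs with hK4
  · rw [jacobiSym_eq_of_mod_four_eq_one hH hK (.inr hK4), mul_comm]
    exact ((χ₄_modEq_self (by exact_mod_cast hH)).mul_left _).symm
  · rw [mul_one]
    rcases (by omega : H % 4 = 1 ∨ H % 4 = 3) with hH4 | hH4
    · rw [jacobiSym_eq_of_mod_four_eq_one hH hK (.inl hH4)]
      have : (H : ℤ) ≡ 1 [ZMOD 4] := by unfold Int.ModEq; omega
      simpa using this.mul_right (jacobiSym K H)
    · rw [jacobiSym.quadratic_reciprocity_three_mod_four hH4 (by omega)]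
      have : (H : ℤ) ≡ -1 [ZMOD 4] := by unfold Int.ModEq; omega
      simpa using this.mul_right (jacobiSym K H)

theorem natCast_mul_jacobiSym_modEq (hH : Odd H) (hK : K ≠ 0) :
    H * jacobiSym K H ≡ jacobiSym H (oddPart K) * twoAdicSign K H [ZMOD 4] := by
  have hfactor : jacobiSym K H =
      jacobiSym (oddPart K) H * (if ¬ 2 ∣ padicValNat 2 K then ZMod.χ₈ H else 1) := by
    have hχ₈ : ZMod.χ₈ H ^ 2 = 1 := by
      simpa using Int.isUnit_sq (isUnit_χ₈ (by exact_mod_cast hH : Odd (H : ℤ)))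
    conv_lhs => rw [← two_pow_mul_oddPart K]
    rw [Nat.cast_mul, jacobiSym.mul_left, Nat.cast_pow, jacobiSym.pow_left, Nat.cast_ofNat,
      jacobiSym.at_two hH, mul_comm]
    congr 1
    obtain ⟨l, hl | hl⟩ := Nat.even_or_odd' (padicValNat 2 K)
    · rw [if_neg (by omega), hl, pow_mul, hχ₈, one_pow]
    · rw [if_pos (by omega), hl, pow_succ, pow_mul, hχ₈, one_pow, one_mul]
  rw [hfactor, ← mul_assoc, twoAdicSign_apply, ← mul_assoc]
  exact_mod_cast (natCast_mul_jacobiSym_modEq_of_odd hH (odd_oddPart hK)).mul_right _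

end TwoAdicSign

section LocalCongruence

variable {H K : ℕ}

/-- The exponent of `i` in the multiplier `exp (-π i s(H, K))`, once the part linear in `H` and its
inverse has been split off; see `dedekindNum_modEq`. -/
def dedekindExponent (K H : ℕ) : ℤ :=
  (if 2 ∣ K then 0 else ((K : ℤ) - 3) / 2) +
    jacobiSym ((-1) ^ K * H) (oddPart K) * (if 2 ∣ K then twoAdicSign K H else 1)

theorem dedekindNum_modEq_of_odd (hK : Odd K) (hc : Nat.Coprime H K) {x : ℤ}
    (hx : dedekindNum H K ≡ x [ZMOD (3 * K : ℕ)]) (hx₈ : x ≡ 0 [ZMOD 8]) :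
    dedekindNum H K ≡ x - 6 * K * dedekindExponent K H [ZMOD 24 * K] := by
  have hexp : 6 * K * dedekindExponent K H =
      3 * K * (K - 3) + 6 * (K * ZMod.χ₄ K) * jacobiSym H K := by
    have h2 : 2 * (((K : ℤ) - 3) / 2) = K - 3 := by have := Nat.odd_iff.mp hK; omega
    rw [dedekindExponent, if_neg hK.not_two_dvd_nat, if_neg hK.not_two_dvd_nat,
      oddPart_eq_self hK, hK.neg_one_pow, neg_one_mul, jacobiSym.neg _ hK]
    linear_combination 3 * K * h2
  have hcop : IsCoprime (8 : ℤ) (3 * K : ℕ) := by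
    have : IsCoprime (2 : ℤ) (3 * K : ℕ) :=
      Int.isCoprime_two_left.mpr (by exact_mod_cast Odd.mul (by decide : Odd 3) hK)
    exact_mod_cast this.pow_left (m := 3)
  rw [show (24 * K : ℤ) = 8 * (3 * K : ℕ) by push_cast; ring]
  refine Int.modEq_iff_dvd.mpr (hcop.mul_dvd ?_ (Int.ModEq.dvd ?_))
  · have hK' : Odd (K : ℤ) := by exact_mod_cast hK
    have hc' : IsCoprime (H : ℤ) K := Nat.isCoprime_iff_coprime.mpr hc
    obtain ⟨c, hD⟩ := (dedekindNum_modEq_eight hK hc').dvd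
    obtain ⟨y, hy⟩ := hx₈.symm.dvd
    obtain ⟨s, hs⟩ := Int.eight_dvd_sq_sub_one_of_odd hK'
    obtain ⟨z, hz⟩ := (χ₄_modEq_self hK').dvd
    obtain ⟨j, hj⟩ : Odd (jacobiSym H K) := by
      rcases jacobiSym.eq_one_or_neg_one (a := H) hc with hJ | hJ <;> rw [hJ] <;> decide
    rw [Int.cast_natCast] at hz
    rw [hexp]
    refine ⟨c + y - 3 * s + K - 1 - j - 6 * s * jacobiSym H K + 3 * z * K * jacobiSym H K, ?_⟩
    linear_combination hD + hy - (3 + 6 * jacobiSym H K) * hs + 6 * K * jacobiSym H K * hz - 4 * hj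
  · refine hx.trans (Int.modEq_iff_dvd.mpr ⟨-(2 * dedekindExponent K H), ?_⟩)
    push_cast
    ring

theorem dedekindNum_modEq_of_odd_left (hH : Odd H) (hK : 0 < K) (hc : Nat.Coprime H K) {x e : ℤ}
    (hx : dedekindNum H K ≡ x [ZMOD (3 * oddPart K : ℕ)])
    (hHx : H * x ≡ (H : ℤ) ^ 2 + K ^ 2 + 3 * K + 1 [ZMOD 2 ^ (3 + padicValNat 2 K)])
    (he : H * jacobiSym K H ≡ e [ZMOD 4]) :
    dedekindNum H K ≡ x - 6 * K * e [ZMOD 24 * K] := by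
  have hfac : (2 : ℤ) ^ padicValNat 2 K * oddPart K = K := by exact_mod_cast two_pow_mul_oddPart K
  have h₂ : IsCoprime ((2 : ℤ) ^ (3 + padicValNat 2 K)) H :=
    (Int.isCoprime_two_left.mpr (by exact_mod_cast hH)).pow_left
  have hcop : IsCoprime ((2 : ℤ) ^ (3 + padicValNat 2 K)) (3 * oddPart K : ℕ) :=
    (Int.isCoprime_two_left.mpr
      (by exact_mod_cast Odd.mul (by decide : Odd 3) (odd_oddPart hK.ne'))).pow_left
  have h8K : (24 * K : ℤ) = 2 ^ (3 + padicValNat 2 K) * (3 * oddPart K : ℕ) := by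
    push_cast
    linear_combination (-24) * hfac
  rw [h8K]
  refine Int.modEq_iff_dvd.mpr (hcop.mul_dvd (h₂.dvd_of_dvd_mul_left ?_) (Int.ModEq.dvd ?_))
  · have he' : 2 * K * jacobiSym K H ≡ -(6 * K * (H * e)) [ZMOD 8 * K] := by
      obtain ⟨y, hy⟩ := he.dvd
      obtain ⟨s, hs⟩ := Int.eight_dvd_sq_sub_one_of_odd (by exact_mod_cast hH : Odd (H : ℤ))
      refine Int.modEq_iff_dvd.mpr ⟨-(3 * H * y + 6 * s * jacobiSym K H + jacobiSym K H), ?_⟩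
      linear_combination (-6 * (K : ℤ) * H) * hy - 6 * K * jacobiSym K H * hs
    have hdvd : (2 : ℤ) ^ (3 + padicValNat 2 K) ∣ 8 * K := ⟨oddPart K, by rw [← hfac]; ring⟩
    have hHD : H * dedekindNum H K ≡ H * (x - 6 * K * e) [ZMOD 2 ^ (3 + padicValNat 2 K)] :=
      calc H * dedekindNum H K
          ≡ H ^ 2 + K ^ 2 + 3 * K + 1 + 2 * K * jacobiSym K H [ZMOD 2 ^ (3 + padicValNat 2 K)] :=
            (mul_dedekindNum_modEq_eight_mul hH hK hc).of_dvd hdvd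
        _ ≡ H * x + -(6 * K * (H * e)) [ZMOD 2 ^ (3 + padicValNat 2 K)] :=
            hHx.symm.add (he'.of_dvd hdvd)
        _ = H * (x - 6 * K * e) := by ring
    rw [mul_sub]
    exact hHD.dvd
  · refine hx.trans (Int.modEq_iff_dvd.mpr ⟨-(2 ^ (1 + padicValNat 2 K) * e), ?_⟩)
    rw [← hfac]
    push_cast
    ring

/-- `t₁` and `t₂` are the Chinese remainder idempotents for the coprime factors `3 * oddPart k` and
`2 ^ (3 + λ)` of `24 * k`, where `λ` is the 2-adic valuation of `k`. -/
structure IsCRTPair (k : ℕ) (t₁ t₂ : ℤ) : Prop where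
  left_odd : t₁ ≡ 1 [ZMOD (3 * oddPart k : ℕ)]
  left_two : t₁ ≡ 0 [ZMOD 2 ^ (3 + padicValNat 2 k)]
  right_two : t₂ ≡ 1 [ZMOD 2 ^ (3 + padicValNat 2 k)]
  right_odd : t₂ ≡ 0 [ZMOD (3 * oddPart k : ℕ)]

namespace IsCRTPair

variable {k : ℕ} {t₁ t₂ : ℤ}

theorem of_dvd (ht : IsCRTPair k t₁ t₂) (hk : k ≠ 0) (hKk : K ∣ k) : IsCRTPair K t₁ t₂ := by
  have hodd : ((3 * oddPart K : ℕ) : ℤ) ∣ (3 * oddPart k : ℕ) :=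
    Int.natCast_dvd_natCast.mpr (Nat.mul_dvd_mul_left 3 (oddPart_dvd_oddPart hKk))
  have htwo := two_pow_add_padicValNat_dvd 3 hk hKk
  exact ⟨ht.left_odd.of_dvd hodd, ht.left_two.of_dvd htwo, ht.right_two.of_dvd htwo,
    ht.right_odd.of_dvd hodd⟩

theorem eight_dvd_left (ht : IsCRTPair k t₁ t₂) : 8 ∣ t₁ := by
  have h8 : (8 : ℤ) ∣ 2 ^ (3 + padicValNat 2 k) :=
    ⟨2 ^ padicValNat 2 k, by rw [pow_add]; norm_num⟩
  exact h8.trans (Int.modEq_zero_iff_dvd.mp ht.left_two)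

theorem three_dvd_right (ht : IsCRTPair k t₁ t₂) : 3 ∣ t₂ := by
  have h3 : (3 : ℤ) ∣ (3 * oddPart k : ℕ) := by exact_mod_cast Nat.dvd_mul_right 3 (oddPart k)
  exact h3.trans (Int.modEq_zero_iff_dvd.mp ht.right_odd)

theorem modEq_odd (ht : IsCRTPair k t₁ t₂) (x y : ℤ) :
    t₁ * x + t₂ * y ≡ x [ZMOD (3 * oddPart k : ℕ)] := by
  simpa using (ht.left_odd.mul_right x).add (ht.right_odd.mul_right y)

theorem modEq_two (ht : IsCRTPair k t₁ t₂) (x y : ℤ) :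
    t₁ * x + t₂ * y ≡ y [ZMOD 2 ^ (3 + padicValNat 2 k)] := by
  simpa using (ht.left_two.mul_right x).add (ht.right_two.mul_right y)

end IsCRTPair

theorem dedekindNum_modEq {t₁ t₂ x y : ℤ} (hK : 0 < K) (hc : Nat.Coprime H K)
    (ht : IsCRTPair K t₁ t₂) (hx : dedekindNum H K ≡ x [ZMOD (3 * oddPart K : ℕ)])
    (hy : 2 ∣ K → H * y ≡ (H : ℤ) ^ 2 + K ^ 2 + 3 * K + 1 [ZMOD 2 ^ (3 + padicValNat 2 K)]) :
    dedekindNum H K ≡ t₁ * x + (if 2 ∣ K then t₂ * y else 0) - 6 * K * dedekindExponent K H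
      [ZMOD 24 * K] := by
  by_cases h2 : 2 ∣ K
  · have hH : Odd H := Nat.coprime_two_right.mp (hc.coprime_dvd_right h2)
    have hexp : dedekindExponent K H = jacobiSym H (oddPart K) * twoAdicSign K H := by
      rw [dedekindExponent, if_pos h2, if_pos h2, (even_iff_two_dvd.mpr h2).neg_one_pow, one_mul,
        zero_add]
    rw [if_pos h2]
    refine dedekindNum_modEq_of_odd_left hH hK hc (hx.trans (ht.modEq_odd x y).symm)
      (((ht.modEq_two x y).mul_left H).trans (hy h2)) ?_
    rw [hexp]
    exact natCast_mul_jacobiSym_modEq hH hK.ne'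
  · have hKodd : Odd K := Nat.not_even_iff_odd.mp fun he => h2 he.two_dvd
    rw [if_neg h2, add_zero]
    refine dedekindNum_modEq_of_odd hKodd hc ?_ ?_
    · have hx' := hx.trans (ht.modEq_odd x 0).symm
      rwa [mul_zero, add_zero, oddPart_eq_self hKodd] at hx'
    · exact Int.modEq_zero_iff_dvd.mpr (ht.eight_dvd_left.mul_right x)

end LocalCongruence

section Characters

theorem exists_dirichletCharacter {R : Type*} [CommMonoidWithZero R] {k : ℕ} (f : ℤ →* R)
    (hf : ∀ a b, a ≡ b [ZMOD k] → f a = f b) :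
    ∃ χ : DirichletCharacter R k, ∀ h : ℤ, IsCoprime h k → χ h = f h := by
  have hcast {x : ZMod k} {h : ℤ} (hx : h = x) : f x.cast = f h :=
    hf _ _ ((ZMod.intCast_eq_intCast_iff _ _ k).mp (by rw [ZMod.intCast_zmod_cast, hx]))
  let g : (ZMod k)ˣ →* R :=
    { toFun x := f (x : ZMod k).cast
      map_one' := by rw [hcast (h := 1) (by simp), map_one]
      map_mul' x y := by
        rw [hcast (h := (x : ZMod k).cast * (y : ZMod k).cast) (by simp), map_mul] }
  refine ⟨MulChar.ofUnitHom g.toHomUnits, fun h hh => ?_⟩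
  obtain ⟨x, hx⟩ := (ZMod.coe_int_isUnit_iff_isCoprime h k).mpr hh.symm
  rw [← hx, MulChar.ofUnitHom_coe]
  exact hcast hx.symm

theorem exists_dirichletCharacter_intCast (R : Type*) [CommRing R] {k : ℕ} (f : ℤ →* ℤ)
    (hf : ∀ a b, a ≡ b [ZMOD k] → f a = f b) :
    ∃ χ : DirichletCharacter R k, ∀ h : ℤ, IsCoprime h k → χ h = (f h : R) :=
  exists_dirichletCharacter ((Int.castRingHom R : ℤ →* R).comp f)
    fun a b hab => congrArg Int.cast (hf a b hab)

theorem kSub_dvd (k m : ℕ) : kSub k m ∣ k :=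
  Nat.div_dvd_of_dvd (Nat.gcd_dvd_right m k)

theorem coprime_mSub_kSub {k : ℕ} (hk : 0 < k) (m : ℕ) : Nat.Coprime (mSub k m) (kSub k m) :=
  Nat.coprime_div_gcd_div_gcd (Nat.gcd_pos_of_pos_right m hk)

theorem odd_mSub {k m : ℕ} (hk : 0 < k) (h2 : 2 ∣ kSub k m) : Odd (mSub k m) :=
  Nat.coprime_two_right.mp ((coprime_mSub_kSub hk m).coprime_dvd_right h2)

variable (M : Finset ℕ) (δ : ℕ → ℤ) (k : ℕ)

/-- The function `chiVal`, which is completely multiplicative on `ℤ`. -/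
def chiHom : ℤ →* ℤ where
  toFun := chiVal M δ k
  map_one' := by simp only [chiVal, jacobiSym.one_left, Finset.prod_const_one]
  map_mul' a b := by simp only [chiVal, jacobiSym.mul_left, Finset.prod_mul_distrib]

/-- The character `ρ`, extended from odd integers to all of `ℤ`; see `psi_one_mul_psi`. -/
def rhoHom : ℤ →* ℤ :=
  ∏ m ∈ M.filter (fun m => ¬ (2 : ℤ) ∣ δ m ∧ 2 ∣ kSub k m), twoAdicSign (kSub k m)

variable {M δ k}

theorem chiHom_congr {a b : ℤ} (hab : a ≡ b [ZMOD k]) : chiHom M δ k a = chiHom M δ k b := by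
  refine Finset.prod_congr rfl fun m _ => ?_
  have hdvd : (oddPart (kSub k m) : ℤ) ∣ k :=
    Int.natCast_dvd_natCast.mpr ((oddPart_dvd _).trans (kSub_dvd k m))
  rw [jacobiSym.mod_left a, hab.of_dvd hdvd, ← jacobiSym.mod_left b]

theorem rhoHom_congr {a b : ℤ} (hab : ∀ m ∈ M, 2 ∣ kSub k m → a ≡ b [ZMOD 8]) :
    rhoHom M δ k a = rhoHom M δ k b := by
  simp only [rhoHom, MonoidHom.finsetProd_apply]
  refine Finset.prod_congr rfl fun m hm => ?_
  obtain ⟨hmM, -, h2⟩ := Finset.mem_filter.mp hm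
  exact twoAdicSign_congr _ (hab m hmM h2)

theorem exists_dirichletCharacter_chi :
    ∃ χ : DirichletCharacter ℂ k, ∀ h : ℤ, IsCoprime h k → χ h = chiVal M δ k h :=
  exists_dirichletCharacter_intCast ℂ (chiHom M δ k) fun _ _ => chiHom_congr

theorem neg_one_zpow_sub_one_div_two {n : ℤ} (hn : Odd n) :
    (((-1 : ℤˣ) ^ ((n - 1) / 2) : ℤˣ) : ℤ) = ZMod.χ₄ n := by
  obtain ⟨l, rfl⟩ := hn
  rw [ZMod.χ₄_int_eq_if_mod_four, if_neg (by omega), add_sub_cancel_right,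
    Int.mul_ediv_cancel_left _ two_ne_zero]
  split_ifs with h
  · rw [Even.neg_one_zpow (Int.even_iff.mpr (by omega)), Units.val_one]
  · rw [Odd.neg_one_zpow (Int.odd_iff.mpr (by omega)), Units.val_neg, Units.val_one]

theorem neg_one_zpow_sq_sub_one_div_eight {n : ℤ} (hn : Odd n) :
    (((-1 : ℤˣ) ^ ((n ^ 2 - 1) / 8) : ℤˣ) : ℤ) = ZMod.χ₈ n := by
  obtain ⟨c, hc⟩ := Int.eight_dvd_sq_sub_one_of_odd hn
  have hn₂ := Int.odd_iff.mp hn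
  have hc₂ : n % 8 = 1 ∨ n % 8 = 7 ↔ Even c := by
    have hsq : n ^ 2 % 16 = (n % 16) ^ 2 % 16 := ((Int.mod_modEq n 16).symm.pow 2)
    rw [Int.even_iff]
    rcases (by omega : n % 16 = 1 ∨ n % 16 = 3 ∨ n % 16 = 5 ∨ n % 16 = 7 ∨ n % 16 = 9 ∨
      n % 16 = 11 ∨ n % 16 = 13 ∨ n % 16 = 15) with h | h | h | h | h | h | h | h <;>
    · rw [h] at hsq
      omega
  rw [ZMod.χ₈_int_eq_if_mod_eight, if_neg (by omega), hc, Int.mul_ediv_cancel_left _ (by norm_num)]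
  split_ifs with h
  · rw [(hc₂.mp h).neg_one_zpow, Units.val_one]
  · rw [(Int.not_even_iff_odd.mp (mt hc₂.mpr h)).neg_one_zpow, Units.val_neg, Units.val_one]

theorem coe_psi (hk : 0 < k) {h : ℤ} (hodd : ∀ m ∈ M, 2 ∣ kSub k m → Odd h) :
    (psi M δ k h : ℤ) =
      ∏ m ∈ M.filter (fun m => ¬ (2 : ℤ) ∣ δ m ∧ 2 ∣ kSub k m),
        twoAdicSign (kSub k m) (h * mSub k m) := by
  have hhm {m : ℕ} (hm : m ∈ M) (h2 : 2 ∣ kSub k m) : Odd (h * mSub k m) :=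
    (hodd m hm h2).mul (by exact_mod_cast odd_mSub hk h2)
  simp only [psi, twoAdicSign_apply, Units.val_mul, Units.coe_prod, Finset.prod_mul_distrib,
    ← Finset.prod_filter, Finset.filter_filter, and_assoc]
  congr 1 <;> refine Finset.prod_congr rfl fun m hm => ?_ <;>
    obtain ⟨hmM, -, h2, -⟩ := Finset.mem_filter.mp hm
  · exact neg_one_zpow_sub_one_div_two (hhm hmM h2)
  · exact neg_one_zpow_sq_sub_one_div_eight (hhm hmM h2)

theorem psi_one_mul_psi (hk : 0 < k) {h : ℤ} (hodd : ∀ m ∈ M, 2 ∣ kSub k m → Odd h) :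
    ((psi M δ k 1 * psi M δ k h : ℤˣ) : ℤ) = rhoHom M δ k h := by
  rw [Units.val_mul, coe_psi hk fun _ _ _ => odd_one, coe_psi hk hodd,
    ← Finset.prod_mul_distrib, rhoHom, MonoidHom.finsetProd_apply]
  refine Finset.prod_congr rfl fun m hm => ?_
  have hunit : IsUnit (twoAdicSign (kSub k m) (mSub k m)) :=
    isUnit_twoAdicSign _ (by exact_mod_cast odd_mSub hk (Finset.mem_filter.mp hm).2.2)
  rw [one_mul, map_mul, mul_left_comm, ← pow_two, Int.isUnit_sq hunit, mul_one]

theorem exists_dirichletCharacter_rho (hk : 0 < k) :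
    ∃ ρ : DirichletCharacter ℂ 8, ∀ h : ℤ, Odd h →
      ρ h = ((psi M δ k 1 * psi M δ k h : ℤˣ) : ℤ) := by
  obtain ⟨ρ, hρ⟩ := exists_dirichletCharacter_intCast ℂ (k := 8) (rhoHom M δ k)
    fun _ _ hab => rhoHom_congr fun _ _ _ => hab
  refine ⟨ρ, fun h hodd => ?_⟩
  have hh : IsCoprime h (8 : ℕ) := by
    exact_mod_cast (Int.isCoprime_two_right.mpr hodd).pow_right (n := 3)
  rw [hρ h hh, psi_one_mul_psi hk fun _ _ _ => hodd]

end Characters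

section Summand

variable {k m : ℕ} {u v w : ℤ}

theorem gcd_mul_kSub (k m : ℕ) : Nat.gcd m k * kSub k m = k :=
  Nat.mul_div_cancel' (Nat.gcd_dvd_right m k)

theorem gcd_mul_mSub (k m : ℕ) : Nat.gcd m k * mSub k m = m :=
  Nat.mul_div_cancel' (Nat.gcd_dvd_left m k)

theorem dvd_gcd_of_coprime_mSub {d : ℕ} (hdm : d ∣ m) (hd : Nat.Coprime d (mSub k m)) :
    d ∣ Nat.gcd m k :=
  hd.dvd_of_dvd_mul_right (by rwa [gcd_mul_mSub])

theorem three_dvd_gcd (hk : 0 < k) (hm : 24 ∣ m) (h3 : 3 ∣ kSub k m) : 3 ∣ Nat.gcd m k :=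
  dvd_gcd_of_coprime_mSub ((by norm_num : 3 ∣ 24).trans hm)
    ((coprime_mSub_kSub hk m).coprime_dvd_right h3).symm

theorem eight_dvd_gcd (hk : 0 < k) (hm : 24 ∣ m) (h2 : 2 ∣ kSub k m) : 8 ∣ Nat.gcd m k :=
  dvd_gcd_of_coprime_mSub ((by norm_num : 8 ∣ 24).trans hm)
    ((Nat.coprime_two_left.mpr (odd_mSub hk h2)).pow_left 3)

theorem gcd_three_mul_kSub_dvd (hk : 0 < k) (hm : 24 ∣ m) :
    Nat.gcd 3 (kSub k m) * kSub k m ∣ k := by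
  conv_rhs => rw [← gcd_mul_kSub k m]
  refine Nat.mul_dvd_mul_right ?_ _
  rcases (Nat.dvd_prime Nat.prime_three).mp (Nat.gcd_dvd_left 3 (kSub k m)) with h | h
  · rw [h]
    exact one_dvd _
  · rw [h]
    exact three_dvd_gcd hk hm (Nat.gcd_eq_left_iff_dvd.mp h)

theorem eight_mul_kSub_dvd (hk : 0 < k) (hm : 24 ∣ m) (h2 : 2 ∣ kSub k m) : 8 * kSub k m ∣ k := by
  conv_rhs => rw [← gcd_mul_kSub k m]
  exact Nat.mul_dvd_mul_right (eight_dvd_gcd hk hm h2) _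

theorem exists_dirichletCharacter_chi_mul_rho {M : Finset ℕ} (δ : ℕ → ℤ) (hk : 0 < k)
    (hM : ∀ m ∈ M, 24 ∣ m) :
    ∃ χ : DirichletCharacter ℂ k, ∀ h : ℤ, IsCoprime h k →
      χ h = (chiVal M δ k h * rhoHom M δ k h : ℤ) := by
  refine exists_dirichletCharacter_intCast ℂ (chiHom M δ k * rhoHom M δ k) fun a b hab => ?_
  have h8 (m : ℕ) (hm : m ∈ M) (h2 : 2 ∣ kSub k m) : a ≡ b [ZMOD 8] :=
    hab.of_dvd (by
      exact_mod_cast (Nat.dvd_mul_right 8 _).trans (eight_mul_kSub_dvd hk (hM m hm) h2))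
  rw [MonoidHom.mul_apply, MonoidHom.mul_apply, chiHom_congr hab, rhoHom_congr h8]

/-- The integers `u`, `v` and `w` are admissible choices of `u_m`, `v_m` and `w_m`. -/
structure IsAdmissible (k m : ℕ) (u v w : ℤ) : Prop where
  u_eq_one : 3 ∣ kSub k m → u = 1
  u_modEq : ¬ 3 ∣ kSub k m → u ≡ 1 [ZMOD kSub k m] ∧ u ≡ 0 [ZMOD 3]
  v_mul_modEq : v * mSub k m ≡ 1 [ZMOD (Nat.gcd 3 (kSub k m) * kSub k m : ℕ)]
  w_mul_modEq : 2 ∣ kSub k m → w * mSub k m ≡ 1 [ZMOD 2 ^ (3 + padicValNat 2 k)]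

theorem IsAdmissible.mul_modEq_one (ha : IsAdmissible k m u v w) (hk : 0 < k) (hm : 24 ∣ m)
    {h h' : ℤ} (hh' : h * h' ≡ 1 [ZMOD k]) :
    mSub k m * h * (v * h') ≡ 1 [ZMOD (Nat.gcd 3 (kSub k m) * kSub k m : ℕ)] :=
  calc mSub k m * h * (v * h')
      = v * mSub k m * (h * h') := by ring
    _ ≡ 1 * 1 [ZMOD (Nat.gcd 3 (kSub k m) * kSub k m : ℕ)] := ha.v_mul_modEq.mul
        (hh'.of_dvd (Int.natCast_dvd_natCast.mpr (gcd_three_mul_kSub_dvd hk hm)))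

theorem IsAdmissible.mul_modEq_two_pow (ha : IsAdmissible k m u v w) (hk : 0 < k) (hm : 24 ∣ m)
    (h2 : 2 ∣ kSub k m) {h h' : ℤ} (hh' : h * h' ≡ 1 [ZMOD k]) :
    mSub k m * h * (mSub k m * h + w * h' * ((kSub k m : ℤ) ^ 2 + 3 * kSub k m + 1)) ≡
      (mSub k m * h) ^ 2 + (kSub k m : ℤ) ^ 2 + 3 * kSub k m + 1
      [ZMOD 2 ^ (3 + padicValNat 2 (kSub k m))] := by
  have hdvd : (2 : ℤ) ^ (3 + padicValNat 2 (kSub k m)) ∣ k := by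
    have : 2 ^ (3 + padicValNat 2 (kSub k m)) ∣ 8 * kSub k m := by
      rw [pow_add]
      exact Nat.mul_dvd_mul_left 8 pow_padicValNat_dvd
    exact_mod_cast this.trans (eight_mul_kSub_dvd hk hm h2)
  have hinv : w * mSub k m * (h * h') ≡ 1 * 1 [ZMOD 2 ^ (3 + padicValNat 2 (kSub k m))] :=
    ((ha.w_mul_modEq h2).of_dvd (two_pow_add_padicValNat_dvd 3 hk.ne' (kSub_dvd k m))).mul
      (hh'.of_dvd hdvd)
  set Q := (kSub k m : ℤ) ^ 2 + 3 * kSub k m + 1 with hQ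
  calc mSub k m * h * (mSub k m * h + w * h' * Q)
      = (mSub k m * h) ^ 2 + w * mSub k m * (h * h') * Q := by ring
    _ ≡ (mSub k m * h) ^ 2 + 1 * 1 * Q [ZMOD 2 ^ (3 + padicValNat 2 (kSub k m))] :=
        (hinv.mul_right _).add_left _
    _ = (mSub k m * h) ^ 2 + (kSub k m : ℤ) ^ 2 + 3 * kSub k m + 1 := by rw [hQ]; ring

/-- The part of `12 k_m s(h m_k, k_m)`, modulo `24 k_m`, that is linear in `h` and its inverse
`h'`; see `dedekindNum_modEq_linearPart`. Multiplied by `gcd(m, k)`, it is the contribution of `m`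
to `-24 (a h + b h')`, up to the factor `δ_m`. -/
def linearPart (k m : ℕ) (u v w t₁ t₂ h h' : ℤ) : ℤ :=
  t₁ * (u * (mSub k m * h + v * h')) +
    if 2 ∣ kSub k m then
      t₂ * (mSub k m * h + w * h' * ((kSub k m : ℤ) ^ 2 + 3 * kSub k m + 1))
    else 0

theorem dedekindNum_modEq_linearPart {h : ℕ} {t₁ t₂ h' : ℤ} (hk : 0 < k) (hm : 24 ∣ m)
    (hh : Nat.Coprime h k) (hh' : h * h' ≡ 1 [ZMOD k]) (ha : IsAdmissible k m u v w)
    (ht : IsCRTPair k t₁ t₂) :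
    dedekindNum (mSub k m * h) (kSub k m) ≡
      linearPart k m u v w t₁ t₂ h h' - 6 * kSub k m * dedekindExponent (kSub k m) (mSub k m * h)
      [ZMOD 24 * kSub k m] := by
  have hK : 0 < kSub k m := Nat.pos_of_dvd_of_pos (kSub_dvd k m) hk
  have hc : Nat.Coprime (mSub k m * h) (kSub k m) :=
    (coprime_mSub_kSub hk m).mul_left (hh.coprime_dvd_right (kSub_dvd k m))
  have hdvd : ((3 * oddPart (kSub k m) : ℕ) : ℤ) ∣ (3 * kSub k m : ℕ) :=
    Int.natCast_dvd_natCast.mpr (Nat.mul_dvd_mul_left 3 (oddPart_dvd _))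
  rw [← Nat.cast_mul]
  refine dedekindNum_modEq hK hc (ht.of_dvd hk.ne' (kSub_dvd k m)) ?_ fun h2 => ?_
  · rw [Nat.cast_mul]
    exact (dedekindNum_modEq_three_mul hK (by exact_mod_cast Nat.isCoprime_iff_coprime.mpr hc)
      (ha.mul_modEq_one hk hm hh') ha.u_eq_one ha.u_modEq).of_dvd hdvd
  · rw [Nat.cast_mul]
    exact ha.mul_modEq_two_pow hk hm h2 hh'

end Summand

section CoefficientSums

variable {M : Finset ℕ} {δ u v w : ℕ → ℤ} {k : ℕ} {t₁ t₂ : ℤ}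

theorem sum_linearPart (M : Finset ℕ) (δ u v w : ℕ → ℤ) (k : ℕ) (t₁ t₂ h h' : ℤ) :
    ∑ m ∈ M, δ m * (Nat.gcd m k * linearPart k m (u m) (v m) (w m) t₁ t₂ h h') =
      -((t₁ * aOne M δ u + t₂ * aTwo M δ k) * h +
        (t₁ * bOne M δ k u v + t₂ * bTwo M δ k w) * h') := by
  simp only [aOne, aTwo, bOne, bTwo, Finset.sum_filter, mul_neg, ← neg_add, neg_mul, neg_neg,
    Finset.mul_sum, Finset.sum_mul, ← Finset.sum_add_distrib]
  refine Finset.sum_congr rfl fun m _ => ?_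
  have hm : (Nat.gcd m k : ℤ) * mSub k m = m := by exact_mod_cast gcd_mul_mSub k m
  rw [linearPart]
  split_ifs
  · linear_combination (δ m * h * (t₁ * u m + t₂)) * hm
  · linear_combination (δ m * h * t₁ * u m) * hm

theorem twentyFour_dvd_aOne_add_aTwo (hM : ∀ m ∈ M, 24 ∣ m) :
    24 ∣ t₁ * aOne M δ u + t₂ * aTwo M δ k := by
  have hM' : ∀ m ∈ M, (24 : ℤ) ∣ m := fun m hm => by exact_mod_cast hM m hm
  have h₁ : 24 ∣ aOne M δ u := (Finset.dvd_sum fun m hm => (hM' m hm).mul_left _).neg_right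
  have h₂ : 24 ∣ aTwo M δ k :=
    (Finset.dvd_sum fun m hm => (hM' m (Finset.mem_filter.mp hm).1).mul_left _).neg_right
  exact dvd_add (h₁.mul_left _) (h₂.mul_left _)

theorem twentyFour_dvd_bOne_add_bTwo (hk : 0 < k) (hM : ∀ m ∈ M, 24 ∣ m)
    (ha : ∀ m ∈ M, IsAdmissible k m (u m) (v m) (w m)) (ht : IsCRTPair k t₁ t₂) :
    24 ∣ t₁ * bOne M δ k u v + t₂ * bTwo M δ k w := by
  have hb₁ : 3 ∣ bOne M δ k u v := by
    refine (Finset.dvd_sum fun m hm => ?_).neg_right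
    by_cases h3 : 3 ∣ kSub k m
    · exact Dvd.dvd.mul_left (by exact_mod_cast three_dvd_gcd hk (hM m hm) h3) _
    · have hu : 3 ∣ u m := Int.modEq_zero_iff_dvd.mp ((ha m hm).u_modEq h3).2
      exact ((hu.mul_left _).mul_right _).mul_right _
  have hb₂ : 8 ∣ bTwo M δ k w := by
    refine (Finset.dvd_sum fun m hm => ?_).neg_right
    obtain ⟨hmM, h2⟩ := Finset.mem_filter.mp hm
    exact .mul_right (.mul_left (by exact_mod_cast eight_dvd_gcd hk (hM m hmM) h2) _) _
  exact dvd_add (mul_dvd_mul ht.eight_dvd_left hb₁) (mul_dvd_mul ht.three_dvd_right hb₂)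

end CoefficientSums

section Exponentiation

variable {M : Finset ℕ} {δ u v w : ℕ → ℤ} {k h : ℕ} {t₁ t₂ a b h' : ℤ}

theorem sum_mul_dedekindNum_modEq (hk : 0 < k) (hM : ∀ m ∈ M, 24 ∣ m)
    (hadm : ∀ m ∈ M, IsAdmissible k m (u m) (v m) (w m)) (ht : IsCRTPair k t₁ t₂)
    (ha : t₁ * aOne M δ u + t₂ * aTwo M δ k = 24 * a)
    (hb : t₁ * bOne M δ k u v + t₂ * bTwo M δ k w = 24 * b)
    (hh : Nat.Coprime h k) (hh' : h * h' ≡ 1 [ZMOD k]) :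
    ∑ m ∈ M, δ m * (Nat.gcd m k * dedekindNum (mSub k m * h) (kSub k m)) ≡
      -(24 * (a * h + b * h')) -
        6 * k * ∑ m ∈ M, δ m * dedekindExponent (kSub k m) (mSub k m * h) [ZMOD 24 * k] := by
  have hgK (m : ℕ) : (Nat.gcd m k : ℤ) * kSub k m = k := by exact_mod_cast gcd_mul_kSub k m
  have hsum : -(24 * (a * h + b * h')) =
      ∑ m ∈ M, δ m * (Nat.gcd m k * linearPart k m (u m) (v m) (w m) t₁ t₂ h h') := by
    rw [sum_linearPart, ha, hb]
    ring
  rw [hsum, Finset.mul_sum, ← Finset.sum_sub_distrib]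
  refine Int.ModEq.sum fun m hm => ?_
  have hmod := ((dedekindNum_modEq_linearPart hk (hM m hm) hh hh' (hadm m hm) ht).mul_left'
    (c := Nat.gcd m k)).mul_left (δ m)
  rw [mul_left_comm (Nat.gcd m k : ℤ) 24, hgK] at hmod
  convert hmod using 1
  linear_combination (6 * δ m * dedekindExponent (kSub k m) (mSub k m * h)) * hgK m

theorem mul_sum_mul_dedekindSum (M : Finset ℕ) (δ : ℕ → ℤ) (hk : 0 < k) (hh : Nat.Coprime h k) :
    24 * (k : ℚ) * (1 / 2 * ∑ m ∈ M, δ m * dedekindSum (mSub k m * h) (kSub k m)) =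
      (∑ m ∈ M, δ m * (Nat.gcd m k * dedekindNum (mSub k m * h) (kSub k m)) : ℤ) := by
  push_cast
  simp only [Finset.mul_sum]
  refine Finset.sum_congr rfl fun m _ => ?_
  have hK : 0 < kSub k m := Nat.pos_of_dvd_of_pos (kSub_dvd k m) hk
  have hc : IsCoprime (mSub k m * h : ℤ) (kSub k m) := by
    exact_mod_cast Nat.isCoprime_iff_coprime.mpr
      ((coprime_mSub_kSub hk m).mul_left (hh.coprime_dvd_right (kSub_dvd k m)))
  have hgK : (Nat.gcd m k : ℚ) * kSub k m = k := by exact_mod_cast gcd_mul_kSub k m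
  rw [← hgK, ← twelve_mul_dedekindSum hK hc]
  ring

theorem exp_eq_exp_mul_I_zpow {N A E : ℤ} (hk : 0 < k)
    (hN : N ≡ -(24 * A) - 6 * k * E [ZMOD 24 * k]) :
    Complex.exp (-2 * Real.pi * Complex.I * (N / (24 * k))) =
      Complex.exp (2 * Real.pi * Complex.I / k * A) * Complex.I ^ E := by
  obtain ⟨z, hz⟩ := hN.dvd
  have hk' : (k : ℂ) ≠ 0 := by exact_mod_cast hk.ne'
  have hN' : (N : ℂ) = -(24 * A) - 6 * k * E - 24 * k * z := by
    rw [sub_eq_iff_eq_add] at hz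
    have := congrArg (Int.cast (R := ℂ)) hz
    push_cast at this
    linear_combination -this
  have hI : Complex.I ^ E = Complex.exp (E * (Real.pi / 2 * Complex.I)) := by
    rw [Complex.exp_int_mul, Complex.exp_pi_div_two_mul_I]
  rw [hI, ← Complex.exp_add, Complex.exp_eq_exp_iff_exists_int]
  refine ⟨z, ?_⟩
  rw [hN']
  field_simp
  ring

theorem prod_zpow_eq_zpow_sum {ι G : Type*} [CommGroupWithZero G] (s : Finset ι) {x : G}
    (hx : x ≠ 0) (f : ι → ℤ) : ∏ i ∈ s, x ^ f i = x ^ ∑ i ∈ s, f i := by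
  induction s using Finset.cons_induction with
  | empty => simp
  | cons i s hi ih => rw [Finset.prod_cons, Finset.sum_cons, ih, zpow_add₀ hx]

theorem I_zpow_mul_of_isUnit {j ε : ℤ} (hj : IsUnit j) (hε : IsUnit ε) :
    Complex.I ^ (j * ε) = Complex.I ^ j * ε := by
  rcases Int.isUnit_iff.mp hj with rfl | rfl <;> rcases Int.isUnit_iff.mp hε with rfl | rfl <;>
    simp

theorem zpow_of_isUnit {ε : ℤ} (hε : IsUnit ε) (d : ℤ) :
    (ε : ℂ) ^ d = if ¬ (2 : ℤ) ∣ d then (ε : ℂ) else 1 := by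
  rcases Int.isUnit_iff.mp hε with rfl | rfl
  · simp
  · rcases Int.even_or_odd d with hd | hd
    · simp [hd.neg_one_zpow, hd.two_dvd]
    · simp [hd.neg_one_zpow, ← even_iff_two_dvd, Int.not_even_iff_odd.mpr hd]

/-- The contribution of a factor `η(q^m)`, with `k_m = K` and `m_k = μ`, to the sign
`χ(h) ψ(h)`. -/
def etaSign (K μ : ℕ) (h : ℤ) : ℤ :=
  jacobiSym h (oddPart K) * if 2 ∣ K then twoAdicSign K (h * μ) else 1

theorem isUnit_jacobiSym {n : ℕ} {x : ℤ} (hx : IsCoprime x n) : IsUnit (jacobiSym x n) :=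
  Int.isUnit_iff.mpr (jacobiSym.eq_one_or_neg_one (Int.isCoprime_iff_gcd_eq_one.mp hx))

theorem isUnit_etaSign {K μ : ℕ} {x : ℤ} (hμ : Nat.Coprime μ K) (hx : IsCoprime x K) :
    IsUnit (etaSign K μ x) := by
  refine (isUnit_jacobiSym (isCoprime_oddPart_right hx)).mul ?_
  split_ifs with h2
  · have h2' : (2 : ℤ) ∣ K := by exact_mod_cast h2
    refine isUnit_twoAdicSign K (.mul ?_ ?_)
    · exact Int.isCoprime_two_right.mp (hx.of_isCoprime_of_dvd_right h2')
    · exact_mod_cast Nat.coprime_two_right.mp (hμ.coprime_dvd_right h2)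
  · exact isUnit_one

theorem I_zpow_dedekindExponent {K μ : ℕ} (hμ : Nat.Coprime μ K) (hh : Nat.Coprime h K) :
    Complex.I ^ dedekindExponent K (μ * h) =
      Complex.I ^ ((if 2 ∣ K then 0 else ((K : ℤ) - 3) / 2) +
        jacobiSym ((-1) ^ K * μ) (oddPart K)) * etaSign K μ h := by
  have hJ : IsUnit (jacobiSym ((-1) ^ K * μ) (oddPart K)) :=
    isUnit_jacobiSym (isCoprime_oddPart_right
      ((isCoprime_mul_unit_left_left (isUnit_one.neg.pow K) _ _).mpr
        (Nat.isCoprime_iff_coprime.mpr hμ)))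
  have hexp : dedekindExponent K (μ * h) = (if 2 ∣ K then 0 else ((K : ℤ) - 3) / 2) +
      jacobiSym ((-1) ^ K * μ) (oddPart K) * etaSign K μ h := by
    rw [dedekindExponent, etaSign, Nat.cast_mul, ← mul_assoc, jacobiSym.mul_left _ (h : ℤ),
      mul_comm (h : ℤ) μ, mul_assoc]
  rw [hexp, zpow_add₀ Complex.I_ne_zero, zpow_add₀ Complex.I_ne_zero, mul_assoc,
    I_zpow_mul_of_isUnit hJ (isUnit_etaSign hμ (Nat.isCoprime_iff_coprime.mpr hh))]

theorem odd_of_coprime (hh : Nat.Coprime h k) {m : ℕ} (h2 : 2 ∣ kSub k m) : Odd (h : ℤ) := by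
  exact_mod_cast Nat.coprime_two_right.mp (hh.coprime_dvd_right (h2.trans (kSub_dvd k m)))

theorem prod_etaSign (hk : 0 < k) (hh : Nat.Coprime h k) :
    ∏ m ∈ M.filter (fun m => ¬ (2 : ℤ) ∣ δ m), etaSign (kSub k m) (mSub k m) h =
      chiVal M δ k h * psi M δ k h := by
  rw [coe_psi hk fun _ _ h2 => odd_of_coprime hh h2, ← Finset.filter_filter, Finset.prod_filter _
    (fun m => twoAdicSign (kSub k m) _), chiVal, ← Finset.prod_mul_distrib]
  rfl

theorem I_zpow_sum_dedekindExponent (hk : 0 < k) (hh : Nat.Coprime h k) :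
    Complex.I ^ ∑ m ∈ M, δ m * dedekindExponent (kSub k m) (mSub k m * h) =
      Complex.I ^ cExp M δ k * (chiVal M δ k h * psi M δ k h : ℤ) := by
  have hcExp : cExp M δ k = ∑ m ∈ M, ((if 2 ∣ kSub k m then 0 else ((kSub k m : ℤ) - 3) / 2) +
      jacobiSym ((-1) ^ kSub k m * mSub k m) (oddPart (kSub k m))) * δ m := by
    rw [cExp, Finset.sum_filter, ← Finset.sum_add_distrib]
    refine Finset.sum_congr rfl fun m _ => ?_
    split_ifs <;> ring
  rw [← prod_zpow_eq_zpow_sum _ Complex.I_ne_zero, hcExp,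
    ← prod_zpow_eq_zpow_sum _ Complex.I_ne_zero, ← prod_etaSign hk hh, Int.cast_prod,
    Finset.prod_filter, ← Finset.prod_mul_distrib]
  refine Finset.prod_congr rfl fun m _ => ?_
  have hhK : Nat.Coprime h (kSub k m) := hh.coprime_dvd_right (kSub_dvd k m)
  rw [mul_comm (δ m), zpow_mul, I_zpow_dedekindExponent (coprime_mSub_kSub hk m) hhK, mul_zpow,
    ← zpow_mul, zpow_of_isUnit (isUnit_etaSign (coprime_mSub_kSub hk m)
      (Nat.isCoprime_iff_coprime.mpr hhK))]

end Exponentiation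

section Coefficient

variable {M : Finset ℕ} {δ u v w : ℕ → ℤ} {k : ℕ} {t₁ t₂ a b : ℤ}

theorem exp_hrr_summand {h : ℕ} {h' : ℤ} (hk : 0 < k) (hM : ∀ m ∈ M, 24 ∣ m)
    (hadm : ∀ m ∈ M, IsAdmissible k m (u m) (v m) (w m)) (ht : IsCRTPair k t₁ t₂)
    (ha : t₁ * aOne M δ u + t₂ * aTwo M δ k = 24 * a)
    (hb : t₁ * bOne M δ k u v + t₂ * bTwo M δ k w = 24 * b)
    (hh : Nat.Coprime h k) (hh' : h * h' ≡ 1 [ZMOD k]) (n : ℤ) :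
    Complex.exp (-2 * Real.pi * Complex.I * (h * n / k +
        1 / 2 * ∑ m ∈ M, δ m * (dedekindSum (mSub k m * h) (kSub k m) : ℂ))) =
      Complex.exp (2 * Real.pi * Complex.I / k * ((a - n : ℤ) * h + b * h')) *
        (Complex.I ^ cExp M δ k * (chiVal M δ k h * psi M δ k h : ℤ)) := by
  have hk' : (k : ℂ) ≠ 0 := by exact_mod_cast hk.ne'
  set N := ∑ m ∈ M, δ m * (Nat.gcd m k * dedekindNum (mSub k m * h) (kSub k m))
  have hS : 1 / 2 * ∑ m ∈ M, δ m * (dedekindSum (mSub k m * h) (kSub k m) : ℂ) = N / (24 * k) := by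
    rw [eq_div_iff (mul_ne_zero (by norm_num) hk'), mul_comm]
    have := congrArg (Rat.cast (K := ℂ)) (mul_sum_mul_dedekindSum M δ hk hh)
    simpa only [Rat.cast_mul, Rat.cast_div, Rat.cast_sum, Rat.cast_intCast, Rat.cast_natCast,
      Rat.cast_ofNat, Rat.cast_one] using this
  rw [hS, mul_add, Complex.exp_add, exp_eq_exp_mul_I_zpow hk
    (sum_mul_dedekindNum_modEq hk hM hadm ht ha hb hh hh'), I_zpow_sum_dedekindExponent hk hh,
    ← mul_assoc, ← Complex.exp_add]
  congr 2
  push_cast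
  field_simp
  ring

theorem hrrCoeff_eq_twistedKloosterman (hk : 0 < k) (hM : ∀ m ∈ M, 24 ∣ m)
    (hadm : ∀ m ∈ M, IsAdmissible k m (u m) (v m) (w m)) (ht : IsCRTPair k t₁ t₂)
    (ha : t₁ * aOne M δ u + t₂ * aTwo M δ k = 24 * a)
    (hb : t₁ * bOne M δ k u v + t₂ * bTwo M δ k w = 24 * b) {χ : DirichletCharacter ℂ k}
    (hχ : ∀ h : ℤ, IsCoprime h k → χ h = (chiVal M δ k h * rhoHom M δ k h : ℤ)) (n : ℤ) :
    hrrCoeff M δ k n =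
      Complex.I ^ cExp M δ k * (psi M δ k 1 : ℤ) * twistedKloosterman χ (a - n) b := by
  rw [hrrCoeff, twistedKloosterman, Finset.mul_sum]
  refine Finset.sum_congr rfl fun h hmem => ?_
  have hh : Nat.Coprime h k := (Finset.mem_filter.mp hmem).2
  have : NeZero k := ⟨hk.ne'⟩
  have hinv : h * (((h : ZMod k)⁻¹).val : ℤ) ≡ 1 [ZMOD k] := by
    refine (ZMod.intCast_eq_intCast_iff _ _ k).mp ?_
    push_cast
    rw [ZMod.natCast_zmod_val, ZMod.coe_mul_inv_eq_one h hh]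
  have hχh : χ (h : ZMod k) = (chiVal M δ k h * rhoHom M δ k h : ℤ) := by
    exact_mod_cast hχ h (Nat.isCoprime_iff_coprime.mpr hh)
  have hψ : (psi M δ k 1 : ℤ) * (chiVal M δ k h * rhoHom M δ k h) =
      chiVal M δ k h * psi M δ k h := by
    rw [← psi_one_mul_psi hk fun _ _ h2 => odd_of_coprime hh h2, Units.val_mul]
    linear_combination chiVal M δ k h * psi M δ k h * Int.units_coe_mul_self (psi M δ k 1)
  have hterm := exp_hrr_summand hk hM hadm ht ha hb hh hinv n
  rw [← hψ, Int.cast_mul] at hterm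
  rw [hχh]
  exact_mod_cast hterm.trans (by push_cast; ring)

end Coefficient

end HRR

theorem theorem4p3
    (M : Finset ℕ) (hMpos : ∀ m ∈ M, 0 < m) (hM24 : ∀ m ∈ M, 24 ∣ m)
    (δ : ℕ → ℤ) (k : ℕ) (hk : 0 < k)
    (u v w : ℕ → ℤ) (t₁ t₂ : ℤ)
    (hu₁ : ∀ m ∈ M, 3 ∣ HRR.kSub k m → u m = 1)
    (hu₂ : ∀ m ∈ M, ¬ 3 ∣ HRR.kSub k m →
      u m ≡ 1 [ZMOD (HRR.kSub k m : ℤ)] ∧ u m ≡ 0 [ZMOD 3])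
    (hv : ∀ m ∈ M,
      v m * (HRR.mSub k m : ℤ) ≡ 1
        [ZMOD ((Nat.gcd 3 (HRR.kSub k m) * HRR.kSub k m : ℕ) : ℤ)])
    (hw : ∀ m ∈ M, 2 ∣ HRR.kSub k m →
      w m * (HRR.mSub k m : ℤ) ≡ 1 [ZMOD (2 : ℤ) ^ (3 + padicValNat 2 k)])
    (ht₁ : t₁ ≡ 1 [ZMOD ((3 * HRR.oddPart k : ℕ) : ℤ)] ∧
      t₁ ≡ 0 [ZMOD (2 : ℤ) ^ (3 + padicValNat 2 k)])
    (ht₂ : t₂ ≡ 1 [ZMOD (2 : ℤ) ^ (3 + padicValNat 2 k)] ∧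
      t₂ ≡ 0 [ZMOD ((3 * HRR.oddPart k : ℕ) : ℤ)]) :
    -- the divisions by 24 that define `a` and `b` are exact
    24 ∣ t₁ * HRR.aOne M δ u + t₂ * HRR.aTwo M δ k ∧
    24 ∣ t₁ * HRR.bOne M δ k u v + t₂ * HRR.bTwo M δ k w ∧
    -- `χ`, `ρ` and their product `χρ` are Dirichlet characters
    ∃ (χ : DirichletCharacter ℂ k) (ρ : DirichletCharacter ℂ 8) (χρ : DirichletCharacter ℂ k),
      (∀ h : ℤ, IsCoprime h (k : ℤ) → χ (h : ZMod k) = ((HRR.chiVal M δ k h : ℤ) : ℂ)) ∧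
      (∀ h : ℤ, Odd h →
        ρ (h : ZMod 8) = (((HRR.psi M δ k 1 * HRR.psi M δ k h : ℤˣ) : ℤ) : ℂ)) ∧
      (∀ h : ℤ, IsCoprime h (2 * (k : ℤ)) → χρ (h : ZMod k) = χ (h : ZMod k) * ρ (h : ZMod 8)) ∧
      ∀ n : ℤ,
        HRR.hrrCoeff M δ k n =
          Complex.I ^ HRR.cExp M δ k * (((HRR.psi M δ k 1 : ℤˣ) : ℤ) : ℂ) *
            HRR.twistedKloosterman χρ
              ((t₁ * HRR.aOne M δ u + t₂ * HRR.aTwo M δ k) / 24 - n)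
              ((t₁ * HRR.bOne M δ k u v + t₂ * HRR.bTwo M δ k w) / 24) := by
  have hadm : ∀ m ∈ M, HRR.IsAdmissible k m (u m) (v m) (w m) := fun m hm =>
    ⟨hu₁ m hm, hu₂ m hm, hv m hm, hw m hm⟩
  have ht : HRR.IsCRTPair k t₁ t₂ := ⟨ht₁.1, ht₁.2, ht₂.1, ht₂.2⟩
  have ha := HRR.twentyFour_dvd_aOne_add_aTwo (δ := δ) (u := u) (k := k) (t₁ := t₁) (t₂ := t₂) hM24
  have hb := HRR.twentyFour_dvd_bOne_add_bTwo (δ := δ) hk hM24 hadm ht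
  obtain ⟨χ, hχ⟩ := HRR.exists_dirichletCharacter_chi (M := M) (δ := δ) (k := k)
  obtain ⟨ρ, hρ⟩ := HRR.exists_dirichletCharacter_rho (M := M) (δ := δ) hk
  obtain ⟨χρ, hχρ⟩ := HRR.exists_dirichletCharacter_chi_mul_rho δ hk hM24
  refine ⟨ha, hb, χ, ρ, χρ, hχ, hρ, fun h hh => ?_, ?_⟩
  · have hodd : Odd h := Int.isCoprime_two_right.mp hh.of_mul_right_left
    rw [hχρ h hh.of_mul_right_right, hχ h hh.of_mul_right_right, hρ h hodd,
      HRR.psi_one_mul_psi hk fun _ _ _ => hodd, Int.cast_mul]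
  · exact HRR.hrrCoeff_eq_twistedKloosterman hk hM24 hadm ht (Int.mul_ediv_cancel' ha).symm
      (Int.mul_ediv_cancel' hb).symm hχρ
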